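/- Let $f$ be a Hecke eigencuspform of weight $\kappa$ for $\mathrm{SL}(2,\mathbb Z)$ (a nonzero cusp form that is an eigenfunction of all Hecke operators $T_n$), with Fourier expansion $f(z)=\sum_{n\ge1}a_f(n)\,n^{(\kappa-1)/2}e^{2\pi i nz}$. For a fundamental discriminant $d$ let $\chi_d=\left(\frac{d}{\cdot}\right)$ be the Kronecker symbol, and for $\mathrm{Re}(s)>1$ let $L(s,f\otimes\chi_d)=\sum_{n\ge1}a_f(n)\chi_d(n)n^{-s}$. Let $k,M\ge1$ be integers and put $$A_{f,M}(s_1,\dots,s_k;w)=\sum_{d}\frac{\chi_d(M)\,L(s_1,f\otimes\chi_d)\cdots L(s_k,f\otimes\chi_d)}{d^{w}},$$ where $d$ runs over the positive fundamental discriminants (including $d=1$). For $S=\{s_1,\dots,s_k\}$ let $$H_{f,M}(S)=\frac1{2\zeta(2)}\sum_{\substack{n_1,\dots,n_k\ge1\\ Mn_1\cdots n_k=\square}}\frac{a_f(n_1)\cdots a_f(n_k)\,a(Mn_1\cdots n_k)}{n_1^{s_1}\cdots n_k^{s_k}},\qquad a(n)=\prod_{p\mid n}\frac{p}{p+1}.$$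 (1) If $\mathrm{Re}(w)>1$ and $\mathrm{Re}(s_j)>1$ for all $j$, then the series defining each $L(s_j,f\otimes\chi_d)$ and the series defining $A_{f,M}(s_1,\dots,s_k;w)$ converge absolutely. (2) $A_{f,M}$ has a meromorphic continuation to the region $\mathrm{Re}(w)>1/2$, $\mathrm{Re}(s_j)>5/4$ for all $j$. It is holomorphic there away from $w=1$, and $(w-1)A_{f,M}(s_1,\dots,s_k;w)$ extends to a holomorphic function on the whole region. For all $s_1,\dots,s_k$ with $\mathrm{Re}(s_j)>5/4$, the series $H_{f,M}(S)$ converges absolutely and $$\operatorname*{Res}_{w=1}A_{f,M}(s_1,\dots,s_k;w)=\lim_{w\to1}(w-1)A_{f,M}(s_1,\dots,s_k;w)=H_{f,M}(S);$$ thus, for fixed $s_1,\dots,s_k$, there is a simple pole at $w=1$ exactly when $H_{f,M}(S)\ne0$, and a removable singularity otherwise. -/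

import Mathlib

open Filter Topology
open scoped MatrixGroups BigOperators

noncomputable section

/-- Fundamental discriminants: `1` and the discriminants of quadratic fields. -/
def IsFundamentalDiscriminant (D : ℤ) : Prop :=
  (D % 4 = 1 ∧ Squarefree D) ∨
    (4 ∣ D ∧ (D / 4 % 4 = 2 ∨ D / 4 % 4 = 3) ∧ Squarefree (D / 4))

/-- The set of positive fundamental discriminants. -/
def posFundDisc : Set ℕ := {d | 0 < d ∧ IsFundamentalDiscriminant (d : ℤ)}

/-- The Kronecker symbol `(D / n)` for `n ≥ 0`. It is completely multiplicative in `n`, it is the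
Legendre symbol at odd primes, and `(D / 2)` is `0` for even `D`, `1` for `D ≡ ±1 mod 8` and `-1`
for `D ≡ ±3 mod 8`. -/
def kroneckerSymbol (D : ℤ) (n : ℕ) : ℤ :=
  if n = 0 then (if D.natAbs = 1 then 1 else 0)
  else ZMod.χ₈ (D : ZMod 8) ^ n.factorization 2 * jacobiSym D (n / 2 ^ n.factorization 2)

/-- The `n`-th Hecke operator in weight `κ` and level one,
`(T_n f)(z) = n ^ (κ - 1) ∑_{a d = n} d ^ (-κ) ∑_{0 ≤ b < d} f ((a z + b) / d)`.
The points `(a z + b) / d` all lie in the upper half-plane. -/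
def heckeOperator (κ : ℤ) (n : ℕ) (f : UpperHalfPlane → ℂ) (z : UpperHalfPlane) : ℂ :=
  (n : ℂ) ^ (κ - 1) * ∑ x ∈ n.divisorsAntidiagonal, (x.2 : ℂ) ^ (-κ) *
    ∑ b ∈ Finset.range x.2,
      f (UpperHalfPlane.ofComplex (((x.1 : ℂ) * (z : ℂ) + (b : ℂ)) / (x.2 : ℂ)))

/-- A Hecke eigencuspform for `SL(2, ℤ)`: a nonzero cusp form that is an eigenfunction of all
Hecke operators. -/
def IsHeckeEigencuspform {κ : ℤ} (f : CuspForm 𝒮ℒ κ) : Prop :=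
  f ≠ 0 ∧ ∀ n : ℕ, 0 < n → ∃ ev : ℂ, ∀ z : UpperHalfPlane, heckeOperator κ n f z = ev * f z

/-- The coefficients `a_f(n)` in `f(z) = ∑_{n ≥ 1} a_f(n) n ^ ((κ - 1) / 2) exp(2 π i n z)`. -/
def normCoeff {κ : ℤ} (f : CuspForm 𝒮ℒ κ) (n : ℕ) : ℂ :=
  (UpperHalfPlane.qExpansion 1 f).coeff n / (((n : ℝ) ^ (((κ : ℝ) - 1) / 2) : ℝ) : ℂ)

/-- The coefficients `a_f(n) χ_d(n)` of `L(s, f ⊗ χ_d)`. -/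
def twistCoeff {κ : ℤ} (f : CuspForm 𝒮ℒ κ) (d : ℕ) (n : ℕ) : ℂ :=
  normCoeff f n * (kroneckerSymbol (d : ℤ) n : ℂ)

/-- The twisted `L`-function `L(s, f ⊗ χ_d) = ∑_{n ≥ 1} a_f(n) χ_d(n) n ^ (-s)`, for `Re s > 1`. -/
def twistL {κ : ℤ} (f : CuspForm 𝒮ℒ κ) (d : ℕ) (s : ℂ) : ℂ :=
  LSeries (twistCoeff f d) s

/-- The summand `χ_d(M) L(s_1, f ⊗ χ_d) ⋯ L(s_k, f ⊗ χ_d) d ^ (-w)`. -/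
def mdsTerm {κ : ℤ} (f : CuspForm 𝒮ℒ κ) (M : ℕ) {k : ℕ} (s : Fin k → ℂ) (w : ℂ) (d : ℕ) : ℂ :=
  (kroneckerSymbol (d : ℤ) M : ℂ) * (∏ j, twistL f d (s j)) / (d : ℂ) ^ w

/-- The multiple Dirichlet series `A_{f,M}(s_1, …, s_k; w)`, in its region of convergence. -/
def mdsA {κ : ℤ} (f : CuspForm 𝒮ℒ κ) (M : ℕ) {k : ℕ} (s : Fin k → ℂ) (w : ℂ) : ℂ :=
  ∑' d : posFundDisc, mdsTerm f M s w (d : ℕ)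

/-- `a(n) = ∏_{p ∣ n} p / (p + 1)`. -/
def arithA (n : ℕ) : ℂ := ∏ p ∈ n.primeFactors, (p : ℂ) / ((p : ℂ) + 1)

/-- The term of `H_{f,M}` at `(n_1, …, n_k)`; it is present only if `M n_1 ⋯ n_k` is a square. -/
def hTerm {κ : ℤ} (f : CuspForm 𝒮ℒ κ) (M : ℕ) {k : ℕ} (s : Fin k → ℂ) (n : Fin k → ℕ+) : ℂ :=
  if IsSquare (M * ∏ j, (n j : ℕ)) then
    (∏ j, normCoeff f (n j)) * arithA (M * ∏ j, (n j : ℕ)) / ∏ j, ((n j : ℕ) : ℂ) ^ s j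
  else 0

/-- `H_{f,M}(S)`, for `S = {s_1, …, s_k}`. -/
def hSum {κ : ℤ} (f : CuspForm 𝒮ℒ κ) (M : ℕ) {k : ℕ} (s : Fin k → ℂ) : ℂ :=
  1 / (2 * riemannZeta 2) * ∑' n : Fin k → ℕ+, hTerm f M s n

/-- The region `Re s_j > 5/4` for all `j`, `Re w > 1/2`, in `ℂ^k × ℂ`. -/
def contRegion (k : ℕ) : Set ((Fin k → ℂ) × ℂ) :=
  {p | (∀ j, 5 / 4 < (p.1 j).re) ∧ 1 / 2 < p.2.re}

end

/-! Expand every `L(s_j, f ⊗ χ_d)` and sum over `d` first. Since `χ_d` is completely multiplicative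
on positive integers, for `Re s_j > 1` and `Re w > 1` the series becomes the sum over `n_1, …, n_k`
of `∏ a_f(n_j) n_j^{-s_j}` times `D_m(w) = ∑_d χ_d(m) d^{-w}` with `m = M n_1 ⋯ n_k`. Everything
then rests on three facts.

Coefficients: Parseval on the horocycle of height `1/N` bounds the mean square of the Fourier
coefficients, so `∑ |a_f(n)| n^{-σ}` converges for `σ > 1`
(`CuspForm.summable_norm_normCoeff_mul_rpow`).

The inner series: sorting fundamental discriminants as `d`, `4d`, `8d` with `d` odd and squarefree,
and using `∑ χ(d) d^{-w} = L(w, χ) / L(2w, χ²)` over squarefree `d`, writes `D_m` through two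
quadratic characters modulo `8m`, namely `(·/m)` on odd integers and its twist by `χ₄`. The twist is
never trivial; the first is trivial exactly when `m` is a square. So `(w - 1) D_m(w)` is holomorphic
for `Re w > 1/2`, and its value at `1` is `a(m) / (2ζ(2))` for square `m` and `0` otherwise: this is
the term of `H_{f,M}`.

Growth in `m`: Pólya–Vinogradov and partial summation give `(w - 1) D_m(w) ≪ m^{1/4+ε}` locally
uniformly on `Re w > 1/2` (`exists_norm_regFundDiscSeries_le`). Convergence of the coefficient
series beyond `1` plus a loss of `1/4` gives normal convergence for `Re s_j > 5/4`. Weierstrass'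
theorem makes the sum `regMds` holomorphic, and setting `w = 1` term by term gives the residue. -/

/-! ### Mean squares of Fourier coefficients -/

section FourierCoefficients

open UpperHalfPlane in
/-- Bessel's inequality for the restriction of a level one cusp form to a horocycle. -/
theorem CuspForm.sum_norm_qExpansion_coeff_sq_le {κ : ℤ} (f : CuspForm 𝒮ℒ κ) {t B : ℝ}
    (ht : 0 < t) (hB : ∀ τ : ℍ, τ.im = t → ‖f τ‖ ≤ B) (s : Finset ℕ) :
    ∑ n ∈ s, (‖(qExpansion 1 f).coeff n‖ * Real.exp (-2 * Real.pi * n * t)) ^ 2 ≤ B ^ 2 := by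
  set g : ℝ → ℂ := fun u => f ⟨u + t * Complex.I, by simpa using ht⟩ with hg
  have hgc : Continuous g := by
    have : Continuous f := (CuspFormClass.holo f).continuous
    refine this.comp ?_
    fun_prop
  have hgB : ∀ u, ‖g u‖ ≤ B := fun u => hB _ (by simp [← UpperHalfPlane.coe_im])
  have hmem : MeasureTheory.MemLp g 2 (MeasureTheory.volume.restrict (Set.Ioc (0 : ℝ) 1)) := by
    refine MeasureTheory.MemLp.of_bound hgc.aestronglyMeasurable B (Eventually.of_forall hgB)
  have hcoeff : ∀ n : ℕ, ‖fourierCoeffOn zero_lt_one g (n : ℤ)‖ =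
      ‖(qExpansion 1 f).coeff n‖ * Real.exp (-2 * Real.pi * n * t) := by
    intro n
    have h1 := ModularFormClass.qExpansion_coeff_eq_intervalIntegral f one_pos
      (by simp : (1 : ℝ) ∈ (𝒮ℒ).strictPeriods) n ht
    have h2 : fourierCoeffOn zero_lt_one g (n : ℤ) =
        (qExpansion 1 f).coeff n * (Real.exp (-2 * Real.pi * n * t) : ℂ) := by
      rw [h1, fourierCoeffOn_eq_integral]
      simp only [sub_zero, div_one, one_smul, Complex.ofReal_one, one_mul]
      rw [← intervalIntegral.integral_mul_const]
      refine intervalIntegral.integral_congr fun u _ => ?_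
      simp only [hg, smul_eq_mul]
      rw [fourier_coe_apply, Function.Periodic.qParam, ← Complex.exp_nat_mul, one_div,
        ← Complex.exp_neg, Complex.ofReal_exp, mul_right_comm (Complex.exp (-_)),
        ← Complex.exp_add]
      congr 2
      push_cast
      have := Complex.I_sq
      ring_nf
      rw [this]
      ring
    rw [h2, norm_mul, Complex.norm_real, Real.norm_of_nonneg (Real.exp_pos _).le]
  have hP := hasSum_sq_fourierCoeffOn zero_lt_one hmem
  have hle : (1 - 0 : ℝ)⁻¹ • ∫ x in (0 : ℝ)..1, ‖g x‖ ^ 2 ≤ B ^ 2 := by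
    have : ∫ x in (0 : ℝ)..1, ‖g x‖ ^ 2 ≤ ∫ x in (0 : ℝ)..1, B ^ 2 := by
      refine intervalIntegral.integral_mono zero_le_one
        ((hgc.norm.pow 2).intervalIntegrable _ _) (by simp) fun u => ?_
      exact pow_le_pow_left₀ (norm_nonneg _) (hgB u) 2
    simpa using this
  refine le_trans ?_ hle
  rw [← hP.tsum_eq]
  have := hP.summable.sum_le_tsum (s.map ⟨((↑) : ℕ → ℤ), Nat.cast_injective⟩)
    (fun i _ => by positivity)
  simpa [hcoeff] using this

-- Bessel at height `1/N` together with `|f(x + iy)| ≤ C y^{-κ/2}`: for `n ≤ N` the weight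
-- `exp(-2πn/N)` is at least `exp(-2π)`, so removing it costs only a constant.
open UpperHalfPlane in
theorem CuspForm.exists_sum_norm_qExpansion_coeff_sq_le {κ : ℤ} (f : CuspForm 𝒮ℒ κ) :
    ∃ C : ℝ, 0 ≤ C ∧ ∀ N : ℕ, 0 < N →
      ∑ n ∈ Finset.Icc 1 N, ‖(qExpansion 1 f).coeff n‖ ^ 2 ≤ C * (N : ℝ) ^ (κ : ℝ) := by
  obtain ⟨C, hC⟩ := CuspFormClass.exists_bound f
  refine ⟨C ^ 2 * Real.exp (2 * Real.pi) ^ 2, by positivity, fun N hN => ?_⟩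
  have hN' : (0 : ℝ) < N := by exact_mod_cast hN
  have h := f.sum_norm_qExpansion_coeff_sq_le (t := 1 / N) (B := C / (1 / N : ℝ) ^ (κ / 2 : ℝ))
    (by positivity) (fun τ hτ => hτ ▸ hC τ) (Finset.Icc 1 N)
  have hpow : (C / (1 / N : ℝ) ^ (κ / 2 : ℝ)) ^ 2 = C ^ 2 * (N : ℝ) ^ (κ : ℝ) := by
    rw [div_pow, one_div, Real.inv_rpow hN'.le, inv_pow, div_inv_eq_mul,
      ← Real.rpow_mul_natCast hN'.le]
    congr 2
    push_cast
    ring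
  rw [hpow] at h
  calc ∑ n ∈ Finset.Icc 1 N, ‖(qExpansion 1 f).coeff n‖ ^ 2
      ≤ ∑ n ∈ Finset.Icc 1 N, (‖(qExpansion 1 f).coeff n‖ *
          Real.exp (-2 * Real.pi * n * (1 / N))) ^ 2 * Real.exp (2 * Real.pi) ^ 2 := by
        refine Finset.sum_le_sum fun n hn => ?_
        rw [← mul_pow, mul_assoc, ← Real.exp_add]
        refine pow_le_pow_left₀ (norm_nonneg _) (le_mul_of_one_le_right (norm_nonneg _) ?_) 2
        refine Real.one_le_exp ?_
        have : (n : ℝ) * (1 / N) ≤ 1 := by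
          rw [mul_one_div, div_le_one hN']
          exact_mod_cast (Finset.mem_Icc.mp hn).2
        nlinarith [Real.pi_pos]
    _ ≤ _ := by
        rw [← Finset.sum_mul]
        calc _ ≤ C ^ 2 * (N : ℝ) ^ (κ : ℝ) * Real.exp (2 * Real.pi) ^ 2 := by gcongr
          _ = _ := by ring

/-- The mean square bound `C N^κ` tends to `0` when `κ < 0`. This disposes of negative weights, for
which the partial summation criterion used next does not apply. -/
theorem CuspForm.normCoeff_eq_zero_of_weight_neg {κ : ℤ} (f : CuspForm 𝒮ℒ κ) (hκ : κ < 0)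
    {n : ℕ} (hn : 0 < n) : normCoeff f n = 0 := by
  obtain ⟨C, hC0, hC⟩ := f.exists_sum_norm_qExpansion_coeff_sq_le
  have hlim : Tendsto (fun N : ℕ => C * (N : ℝ) ^ (κ : ℝ)) atTop (𝓝 (C * 0)) := by
    refine Tendsto.const_mul _ ?_
    have := (tendsto_rpow_neg_atTop (y := -(κ : ℝ)) (by simpa using hκ)).comp
      tendsto_natCast_atTop_atTop
    simpa [Function.comp_def] using this
  have : ‖(UpperHalfPlane.qExpansion 1 f).coeff n‖ ^ 2 ≤ C * 0 := by
    refine ge_of_tendsto hlim ?_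
    filter_upwards [eventually_ge_atTop n] with N hN
    refine le_trans ?_ (hC N (hn.trans_le hN))
    exact Finset.single_le_sum (f := fun n => ‖(UpperHalfPlane.qExpansion 1 f).coeff n‖ ^ 2)
      (fun i _ => by positivity) (Finset.mem_Icc.mpr ⟨hn, hN⟩)
  have h0 : (UpperHalfPlane.qExpansion 1 f).coeff n = 0 := by
    have h' : ‖(UpperHalfPlane.qExpansion 1 f).coeff n‖ ^ 2 = 0 :=
      le_antisymm (by simpa using this) (by positivity)
    simpa using h'
  simp [normCoeff, h0]

/-- Absolute convergence of the Dirichlet series of the normalized coefficients to the right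
of the line `Re s = 1`. -/
theorem CuspForm.summable_norm_normCoeff_mul_rpow {κ : ℤ} (f : CuspForm 𝒮ℒ κ) {σ : ℝ}
    (hσ : 1 < σ) : Summable fun n : ℕ+ => ‖normCoeff f n‖ * (n : ℝ) ^ (-σ) := by
  rcases lt_or_ge κ 0 with hκ | hκ
  · simp [f.normCoeff_eq_zero_of_weight_neg hκ (PNat.pos _)]
  obtain ⟨C, hC0, hC⟩ := f.exists_sum_norm_qExpansion_coeff_sq_le
  set c : ℕ → ℂ := fun n => (UpperHalfPlane.qExpansion 1 f).coeff n with hc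
  set ε : ℝ := σ - 1 with hε
  have hε0 : 0 < ε := by linarith
  have h1 : LSeriesSummable (fun n => ((‖c n‖ ^ 2 : ℝ) : ℂ)) ((κ + ε : ℝ) : ℂ) := by
    refine LSeriesSummable_of_sum_norm_bigO_and_nonneg (r := κ) ?_ (fun n => by positivity)
      (by exact_mod_cast hκ) (by simpa using hε0)
    refine Asymptotics.IsBigO.of_bound C ?_
    filter_upwards [eventually_gt_atTop 0] with N hN
    rw [Real.norm_of_nonneg (Finset.sum_nonneg fun i _ => by positivity),
      Real.norm_of_nonneg (by positivity)]
    exact hC N hN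
  have h1' : Summable fun n : ℕ+ => ‖c n‖ ^ 2 * (n : ℝ) ^ (-(κ + ε)) := by
    have := (h1.norm).comp_injective PNat.coe_injective
    refine this.congr fun n => ?_
    simp only [Function.comp]
    rw [LSeries.norm_term_eq, if_neg n.ne_zero, Complex.norm_real,
      Real.norm_of_nonneg (by positivity), Complex.ofReal_re, Real.rpow_neg (by positivity),
      div_eq_mul_inv]
  have h2 : Summable fun n : ℕ+ => ((n : ℕ) : ℝ) ^ (-σ) :=
    (Real.summable_nat_rpow.mpr (by linarith)).comp_injective PNat.coe_injective
  refine Summable.of_nonneg_of_le (fun n => by positivity) (fun n => ?_) (h1'.add h2)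
  have hn : (0 : ℝ) < ((n : ℕ) : ℝ) := by exact_mod_cast n.pos
  have e1 : ‖normCoeff f n‖ = ‖c n‖ * ((n : ℕ) : ℝ) ^ (-((κ - 1) / 2 : ℝ)) := by
    rw [normCoeff, norm_div, Complex.norm_real, Real.norm_of_nonneg (by positivity),
      Real.rpow_neg hn.le, div_eq_mul_inv]
  -- Each term is a product `x y` with `∑ x²` controlled by the mean square and `∑ y² = ∑ n^{-σ}`;
  -- then `x y ≤ x² + y²`.
  set x := ‖c n‖ * ((n : ℕ) : ℝ) ^ (-((κ + ε) / 2)) with hx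
  set y := ((n : ℕ) : ℝ) ^ (-σ / 2) with hy
  have e2 : ‖normCoeff f n‖ * ((n : ℕ) : ℝ) ^ (-σ) = x * y := by
    rw [e1, hx, hy, mul_assoc, mul_assoc, ← Real.rpow_add hn, ← Real.rpow_add hn]
    congr 2
    rw [hε]
    ring
  have e3 : ‖c n‖ ^ 2 * ((n : ℕ) : ℝ) ^ (-(κ + ε)) = x ^ 2 := by
    rw [hx, mul_pow, ← Real.rpow_mul_natCast hn.le]
    congr 2
    push_cast
    ring
  have e4 : ((n : ℕ) : ℝ) ^ (-σ) = y ^ 2 := by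
    rw [hy, ← Real.rpow_mul_natCast hn.le]
    congr 1
    push_cast
    ring
  rw [e2, e3, e4]
  nlinarith [sq_nonneg (x - y), sq_nonneg x, sq_nonneg y]

end FourierCoefficients

/-! ### The Pólya–Vinogradov inequality -/

section PolyaVinogradov

open ZMod

/-- The discrete Fourier transform of a primitive `χ` is a multiple of `χ⁻¹` by its Gauss sum.
Transforming twice gives `q` times reflection, so the Gauss sums of `χ` and `χ⁻¹` multiply to `±q`;
up to the same sign they are complex conjugates. -/
theorem DirichletCharacter.norm_gaussSum_stdAddChar_sq {q : ℕ} [NeZero q]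
    {χ : DirichletCharacter ℂ q} (hχ : χ.IsPrimitive) :
    ‖gaussSum χ stdAddChar‖ ^ 2 = q := by
  have hχ' : (χ⁻¹).IsPrimitive := by
    rw [isPrimitive_def, conductor_inv, hχ]
  have hconj : χ (-1) * gaussSum χ⁻¹ stdAddChar = (starRingEnd ℂ) (gaussSum χ stdAddChar) := by
    have h := hχ'.fourierTransform_eq_inv_mul_gaussSum 1
    rw [inv_inv, ZMod.dft_apply] at h
    rw [← h, gaussSum, map_sum]
    refine Finset.sum_congr rfl fun j _ => ?_
    rw [map_mul, mul_one, smul_eq_mul, mul_comm, AddChar.map_neg_eq_conj, starRingEnd_apply,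
      starRingEnd_apply, MulChar.star_apply']
  have h1 := congr_fun (ZMod.dft_dft (χ : ZMod q → ℂ)) (-1)
  have h2 : ZMod.dft (χ : ZMod q → ℂ) =
      (χ⁻¹ (-1) * gaussSum χ stdAddChar) • ((χ⁻¹ : DirichletCharacter ℂ q) : ZMod q → ℂ) := by
    ext k
    rw [hχ.fourierTransform_eq_inv_mul_gaussSum, neg_eq_neg_one_mul k, map_mul, Pi.smul_apply,
      smul_eq_mul]
    ring
  have h3 : χ⁻¹ (-1) * χ (-1) = 1 := by
    rw [← MulChar.mul_apply, inv_mul_cancel, MulChar.one_apply (by simp)]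
  rw [h2, _root_.map_smul, Pi.smul_apply, hχ'.fourierTransform_eq_inv_mul_gaussSum, inv_inv] at h1
  simp only [neg_neg, map_one, smul_eq_mul, mul_one, one_mul] at h1
  have h4 : gaussSum χ⁻¹ stdAddChar = χ⁻¹ (-1) * (starRingEnd ℂ) (gaussSum χ stdAddChar) := by
    rw [← hconj, ← mul_assoc, h3, one_mul]
  have h5 : χ⁻¹ (-1) * χ⁻¹ (-1) = 1 := by
    rw [← map_mul]; simp
  have h6 : gaussSum χ stdAddChar * (starRingEnd ℂ) (gaussSum χ stdAddChar) = q := by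
    rw [h4] at h1
    linear_combination h1 - (gaussSum χ stdAddChar) *
      (starRingEnd ℂ) (gaussSum χ stdAddChar) * h5
  rw [Complex.mul_conj, Complex.normSq_eq_norm_sq] at h6
  exact_mod_cast h6

theorem Real.two_mul_min_le_sin_pi_mul {t : ℝ} (h0 : 0 ≤ t) (h1 : t ≤ 1) :
    2 * min t (1 - t) ≤ Real.sin (Real.pi * t) := by
  have key : ∀ x : ℝ, 0 ≤ x → x ≤ 1 / 2 → 2 * x ≤ Real.sin (Real.pi * x) := fun x hx hx' => by
    have := Real.mul_le_sin (x := Real.pi * x) (by positivity) (by nlinarith [Real.pi_pos])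
    rwa [← mul_assoc, div_mul_cancel₀ _ Real.pi_ne_zero] at this
  rcases le_total t (1 / 2) with h | h
  · rw [min_eq_left (by linarith)]
    exact key t h0 h
  · rw [min_eq_right (by linarith)]
    have := key (1 - t) (by linarith) (by linarith)
    rwa [mul_sub Real.pi, mul_one, Real.sin_pi_sub] at this

/-- A geometric sum is at most `2 / |z - 1|`, and `|z - 1| = 2 sin(πj/q) ≥ 4 min(j, q - j) / q`. The
reciprocal of the minimum is relaxed to a sum of reciprocals, which is easier to sum over `j`. -/
theorem ZMod.norm_sum_stdAddChar_neg_mul_le {q : ℕ} [NeZero q] {j : ℕ} (hj : 0 < j) (hjq : j < q)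
    (N : ℕ) : ‖∑ k ∈ Finset.range N, stdAddChar (-((j : ZMod q) * (k : ZMod q)))‖ ≤
      q / 2 * (1 / (j : ℝ) + 1 / ((q - j : ℕ) : ℝ)) := by
  set z : ℂ := stdAddChar (-(j : ZMod q)) with hz
  have hpow : ∀ k : ℕ, stdAddChar (-((j : ZMod q) * (k : ZMod q))) = z ^ k := fun k => by
    rw [hz, ← AddChar.map_nsmul_eq_pow]
    congr 1
    simp [nsmul_eq_mul, mul_comm]
  have hq : (0 : ℝ) < q := by exact_mod_cast hj.trans hjq
  have hz1 : ‖z‖ = 1 := by rw [hz, stdAddChar_apply, Circle.norm_coe]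
  have hj' : (0 : ℝ) < j := by exact_mod_cast hj
  have hqj : (0 : ℝ) < ((q - j : ℕ) : ℝ) := by exact_mod_cast Nat.sub_pos_of_lt hjq
  have hcast : ((q - j : ℕ) : ℝ) = q - j := by rw [Nat.cast_sub hjq.le]
  have hlow : 4 * min (j : ℝ) ((q - j : ℕ) : ℝ) / q ≤ ‖z - 1‖ := by
    have hze : z = Complex.exp (Complex.I * ((-(2 * Real.pi * (j / q)) : ℝ) : ℂ)) := by
      have := stdAddChar_coe (N := q) (-(j : ℤ))
      rw [hz]
      push_cast at this
      rw [this]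
      congr 1
      push_cast
      ring
    rw [hze, Complex.norm_exp_I_mul_ofReal_sub_one]
    have hs := Real.two_mul_min_le_sin_pi_mul (t := j / q) (by positivity)
      (by rw [div_le_one hq]; exact_mod_cast hjq.le)
    have e1 : -(2 * Real.pi * (j / q : ℝ)) / 2 = -(Real.pi * (j / q)) := by ring
    rw [e1, Real.sin_neg, mul_neg, norm_neg, Real.norm_eq_abs]
    refine le_trans ?_ (le_abs_self _)
    have e2 : (1 : ℝ) - j / q = ((q - j : ℕ) : ℝ) / q := by
      rw [hcast]; field_simp
    rw [e2, min_div_div_right hq.le] at hs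
    calc _ = 2 * (2 * (min (j : ℝ) ((q - j : ℕ) : ℝ) / q)) := by ring
      _ ≤ _ := by linarith
  have hmin : 0 < min (j : ℝ) ((q - j : ℕ) : ℝ) := lt_min hj' hqj
  have hpos : 0 < ‖z - 1‖ := lt_of_lt_of_le (by positivity) hlow
  have hne : z ≠ 1 := fun h => by simp [h] at hpos
  simp_rw [hpow]
  rw [geom_sum_eq hne, norm_div]
  calc ‖z ^ N - 1‖ / ‖z - 1‖ ≤ 2 / (4 * min (j : ℝ) ((q - j : ℕ) : ℝ) / q) := by
        gcongr
        refine (norm_sub_le _ _).trans ?_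
        rw [norm_pow, hz1]
        norm_num
    _ = q / 2 * (1 / min (j : ℝ) ((q - j : ℕ) : ℝ)) := by field_simp; norm_num
    _ ≤ _ := by
        gcongr
        rcases min_choice (j : ℝ) ((q - j : ℕ) : ℝ) with h | h <;> rw [h]
        · exact le_add_of_nonneg_right (by positivity)
        · exact le_add_of_nonneg_left (by positivity)

theorem ZMod.sum_univ_eq_sum_range {q : ℕ} [NeZero q] {M : Type*} [AddCommMonoid M]
    (g : ZMod q → M) : ∑ j, g j = ∑ j ∈ Finset.range q, g (j : ZMod q) := by
  refine Finset.sum_nbij' ZMod.val (fun n => (n : ZMod q)) ?_ ?_ ?_ ?_ ?_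
  · intro a _; simpa using ZMod.val_lt a
  · simp
  · intro a _; simp
  · intro a ha; exact ZMod.val_cast_of_lt (Finset.mem_range.mp ha)
  · intro a _; simp

/-- The **Pólya–Vinogradov inequality** for primitive characters. -/
theorem DirichletCharacter.norm_sum_range_le_of_isPrimitive {q : ℕ} (hq : 1 < q)
    {χ : DirichletCharacter ℂ q} (hχ : χ.IsPrimitive) (N : ℕ) :
    ‖∑ k ∈ Finset.range N, χ k‖ ≤ Real.sqrt q * (1 + Real.log q) := by
  have : NeZero q := ⟨by omega⟩
  have hq0 : (0 : ℝ) < q := by exact_mod_cast this.pos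
  have hχ' : (χ⁻¹).IsPrimitive := by
    rw [isPrimitive_def, conductor_inv, hχ]
  set τ := gaussSum χ⁻¹ (stdAddChar (N := q)) with hτ
  have hτn : ‖τ‖ = Real.sqrt q := by
    rw [← norm_gaussSum_stdAddChar_sq hχ', Real.sqrt_sq (norm_nonneg _)]
  -- Primitivity allows `χ` to be expanded in additive characters at every residue, including
  -- nonunits; summing over `k` leaves geometric sums.
  have hfou : ∀ k : ZMod q, χ (-1) * τ * χ k = ∑ j : ZMod q, stdAddChar (-(j * k)) * χ⁻¹ j := by
    intro k
    have h := hχ'.fourierTransform_eq_inv_mul_gaussSum (k := k)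
    rw [ZMod.dft_apply, inv_inv] at h
    simp only [smul_eq_mul] at h
    rw [h, neg_eq_neg_one_mul k, map_mul]
    ring
  have hsum : χ (-1) * τ * ∑ k ∈ Finset.range N, χ k =
      ∑ j ∈ Finset.range q, χ⁻¹ j * ∑ k ∈ Finset.range N,
        stdAddChar (-((j : ZMod q) * (k : ZMod q))) := by
    rw [Finset.mul_sum]
    simp_rw [hfou, ZMod.sum_univ_eq_sum_range, Finset.mul_sum]
    rw [Finset.sum_comm]
    exact Finset.sum_congr rfl fun _ _ => Finset.sum_congr rfl fun _ _ => mul_comm _ _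
  have hbd : ‖χ (-1) * τ * ∑ k ∈ Finset.range N, χ k‖ ≤ q * (1 + Real.log q) := by
    rw [hsum, Finset.range_eq_Ico, Finset.sum_eq_sum_Ico_succ_bot this.pos]
    have h0 : χ⁻¹ ((0 : ℕ) : ZMod q) = 0 := by
      have : Nontrivial (ZMod q) := ZMod.nontrivial_iff.mpr hq.ne'
      rw [Nat.cast_zero]; exact MulChar.map_zero _
    rw [h0, zero_mul, zero_add, zero_add]
    calc _ ≤ ∑ j ∈ Finset.Ico 1 q, ((q : ℝ) / 2 * (1 / (j : ℝ) + 1 / ((q - j : ℕ) : ℝ))) := by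
          refine norm_sum_le_of_le _ fun j hj => ?_
          rw [Finset.mem_Ico] at hj
          rw [norm_mul]
          refine (mul_le_of_le_one_left (norm_nonneg _) (χ⁻¹.norm_le_one _)).trans ?_
          exact ZMod.norm_sum_stdAddChar_neg_mul_le hj.1 hj.2 N
      _ = q * ∑ j ∈ Finset.Ico 1 q, (1 / (j : ℝ)) := by
          rw [← Finset.mul_sum, Finset.sum_add_distrib]
          have : ∑ j ∈ Finset.Ico 1 q, (1 / ((q - j : ℕ) : ℝ)) =
              ∑ j ∈ Finset.Ico 1 q, (1 / (j : ℝ)) := by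
            refine Finset.sum_nbij' (fun j => q - j) (fun j => q - j) ?_ ?_ ?_ ?_ ?_ <;>
              intro j hj <;> simp only [Finset.mem_Ico] at hj ⊢ <;> omega
          rw [this]
          ring
      _ ≤ q * (1 + Real.log q) := by
          gcongr
          refine le_trans ?_ (harmonic_le_one_add_log q)
          rw [harmonic_eq_sum_Icc]
          push_cast
          simp_rw [one_div]
          exact Finset.sum_le_sum_of_subset_of_nonneg
            (fun j hj => by simp only [Finset.mem_Ico, Finset.mem_Icc] at hj ⊢; omega)
            fun _ _ _ => by positivity
  have hneg : ‖χ (-1)‖ = 1 := by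
    simpa using χ.unit_norm_eq_one (-1)
  rw [norm_mul, norm_mul, hneg, one_mul, hτn] at hbd
  -- Dividing by `|τ| = √q` turns the bound `q (1 + log q)` into `√q (1 + log q)`.
  have hs : 0 < Real.sqrt q := Real.sqrt_pos.mpr hq0
  refine le_of_mul_le_mul_left (hbd.trans_eq ?_) hs
  rw [← mul_assoc, Real.mul_self_sqrt hq0.le]

end PolyaVinogradov

/-! ### Bounds for Dirichlet L-functions in the conductor aspect -/

section ConvexityBound

open MeasureTheory

/-- Primes above `2^{1/ε}` satisfy `2 ≤ p^ε`; the boundedly many smaller ones go into the constant.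
-/
theorem Nat.exists_two_pow_card_primeFactors_le {ε : ℝ} (hε : 0 < ε) :
    ∃ C : ℝ, 0 < C ∧ ∀ n : ℕ, 0 < n → (2 : ℝ) ^ n.primeFactors.card ≤ C * (n : ℝ) ^ ε := by
  set K : ℕ := ⌈(2 : ℝ) ^ (1 / ε)⌉₊ with hK
  refine ⟨2 ^ (K + 1), by positivity, fun n hn => ?_⟩
  have hlarge : ∀ p : ℕ, K < p → (2 : ℝ) ≤ (p : ℝ) ^ ε := fun p hp => by
    have h1 : (2 : ℝ) ^ (1 / ε) ≤ p := (Nat.le_ceil _).trans (by exact_mod_cast hp.le)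
    calc (2 : ℝ) = ((2 : ℝ) ^ (1 / ε)) ^ ε := by
          rw [← Real.rpow_mul (by norm_num), one_div_mul_cancel hε.ne', Real.rpow_one]
      _ ≤ _ := Real.rpow_le_rpow (by positivity) h1 hε.le
  calc (2 : ℝ) ^ n.primeFactors.card = ∏ _p ∈ n.primeFactors, (2 : ℝ) := by simp
    _ ≤ ∏ p ∈ n.primeFactors, ((if p ≤ K then 2 else 1) * (p : ℝ) ^ ε) := by
        refine Finset.prod_le_prod (fun _ _ => by norm_num) fun p hp => ?_
        have hp1 : (1 : ℝ) ≤ p := by exact_mod_cast (Nat.prime_of_mem_primeFactors hp).one_le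
        split_ifs with h
        · exact le_mul_of_one_le_right (by norm_num) (Real.one_le_rpow hp1 hε.le)
        · rw [one_mul]; exact hlarge p (not_le.mp h)
    _ = 2 ^ (n.primeFactors.filter (· ≤ K)).card * ((∏ p ∈ n.primeFactors, p : ℕ) : ℝ) ^ ε := by
        rw [Finset.prod_mul_distrib, Finset.prod_ite, Finset.prod_const, Finset.prod_const_one,
          mul_one, Nat.cast_prod, Real.finsetProd_rpow _ _ (fun _ _ => by positivity)]
    _ ≤ _ := by
        gcongr
        · norm_num
        · calc _ ≤ (Finset.range (K + 1)).card := Finset.card_le_card fun p hp => by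
                have := (Finset.mem_filter.mp hp).2
                exact Finset.mem_range.mpr (by omega)
            _ = K + 1 := Finset.card_range _
        · exact Nat.le_of_dvd hn (Nat.prod_primeFactors_dvd n)

theorem DirichletCharacter.norm_prod_one_sub_le {q c : ℕ} (χ : DirichletCharacter ℂ c) {w : ℂ}
    (hw : 0 ≤ w.re) :
    ‖∏ p ∈ q.primeFactors, (1 - χ p * (p : ℂ) ^ (-w))‖ ≤ 2 ^ q.primeFactors.card := by
  rw [norm_prod, ← Finset.prod_const]
  refine Finset.prod_le_prod (fun _ _ => norm_nonneg _) fun p hp => ?_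
  have hp := Nat.prime_of_mem_primeFactors hp
  refine (norm_sub_le _ _).trans ?_
  rw [norm_one, norm_mul, Complex.norm_natCast_cpow_of_pos hp.pos, Complex.neg_re]
  have h1 : (p : ℝ) ^ (-w.re) ≤ 1 :=
    Real.rpow_le_one_of_one_le_of_nonpos (by exact_mod_cast hp.one_le) (by linarith)
  have h2 := χ.norm_le_one p
  have h3 : 0 ≤ (p : ℝ) ^ (-w.re) := by positivity
  nlinarith [norm_nonneg (χ p)]

/-- Abel summation: a bound for the partial sums of a nontrivial character gives a bound for its
`L`-function to the right of the line `Re w = 1 / 2`. -/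
theorem DirichletCharacter.norm_LFunction_le_of_norm_sum_le {q : ℕ} [NeZero q]
    {χ : DirichletCharacter ℂ q} (hχ : χ ≠ 1) {P : ℝ}
    (hP : ∀ N : ℕ, ‖∑ k ∈ Finset.range N, χ k‖ ≤ P) {w : ℂ} (hw : 1 / 2 < w.re) :
    ‖χ.LFunction w‖ ≤ ‖w‖ * (Real.sqrt P / (w.re - 1 / 2)) := by
  have hq : q ≠ 1 := by
    rintro rfl
    exact hχ (Subsingleton.elim _ _)
  have hP0 : 0 ≤ P := (norm_nonneg _).trans (hP 0)
  have hχ0 : χ ((0 : ℕ) : ZMod q) = 0 := by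
    have : Nontrivial (ZMod q) := ZMod.nontrivial_iff.mpr hq
    rw [Nat.cast_zero]; exact MulChar.map_zero _
  set T : ℕ → ℂ := fun n => ∑ k ∈ Finset.Icc 1 n, χ k with hT
  have hTP : ∀ n, ‖T n‖ ≤ P := fun n => by
    have := hP (n + 1)
    rwa [Finset.range_eq_Ico, Finset.sum_eq_sum_Ico_succ_bot n.succ_pos, hχ0, zero_add,
      zero_add] at this
  have hTn : ∀ n, ‖T n‖ ≤ n := fun n => by
    refine (norm_sum_le_of_le _ (n := fun _ => (1 : ℝ)) fun k _ => χ.norm_le_one _).trans ?_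
    simp
  have hmeas : Measurable fun t : ℝ => T ⌊t⌋₊ :=
    (measurable_from_nat (f := T)).comp Nat.measurable_floor
  -- Cut off to vanish on `t ≤ 1` and bounded at infinity, `g` has a Mellin transform at `-z` that
  -- is holomorphic for `Re z > 0`.
  set g : ℝ → ℂ := (Set.Ioi (1 : ℝ)).indicator fun t => T ⌊t⌋₊ with hg
  have hgP : ∀ t, ‖g t‖ ≤ P := fun t => by
    refine (norm_indicator_le_norm_self _ _).trans (hTP _)
  have hloc : LocallyIntegrableOn g (Set.Ioi 0) := by
    refine ((locallyIntegrable_const P).mono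
      (hmeas.indicator measurableSet_Ioi).aestronglyMeasurable
      (Eventually.of_forall fun t => ?_)).locallyIntegrableOn _
    rw [Real.norm_of_nonneg hP0]
    exact hgP t
  have htop : g =O[atTop] (fun t : ℝ => t ^ (-(0 : ℝ))) := by
    refine Asymptotics.IsBigO.of_bound P (Eventually.of_forall fun t => ?_)
    simpa using hgP t
  have hbot : ∀ b : ℝ, g =O[𝓝[>] 0] (fun t : ℝ => t ^ (-b)) := fun b => by
    refine Asymptotics.IsBigO.of_bound 0 ?_
    filter_upwards [mem_nhdsWithin_of_mem_nhds (Iio_mem_nhds (zero_lt_one (α := ℝ)))] with t ht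
    have : t ∉ Set.Ioi (1 : ℝ) := fun h => lt_asymm (Set.mem_Ioi.mp h) (Set.mem_Iio.mp ht)
    simp [hg, this]
  have hmellin : ∀ z : ℂ, mellin g (-z) =
      ∫ t in Set.Ioi (1 : ℝ), T ⌊t⌋₊ * (t : ℂ) ^ (-(z + 1)) := by
    intro z
    rw [mellin]
    have : ∀ t : ℝ, (t : ℂ) ^ (-z - 1) • g t =
        (Set.Ioi (1 : ℝ)).indicator (fun t : ℝ => T ⌊t⌋₊ * (t : ℂ) ^ (-(z + 1))) t := fun t => by
      by_cases ht : t ∈ Set.Ioi (1 : ℝ)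
      · rw [Set.indicator_of_mem ht, hg, Set.indicator_of_mem ht, smul_eq_mul, mul_comm]
        congr 2
        ring
      · rw [Set.indicator_of_notMem ht, hg, Set.indicator_of_notMem ht, smul_zero]
    simp_rw [this]
    rw [setIntegral_indicator measurableSet_Ioi]
    congr 2
    exact Set.inter_eq_right.mpr (Set.Ioi_subset_Ioi zero_le_one)
  have hdiff : DifferentiableOn ℂ (fun z => z * mellin g (-z)) {z : ℂ | 0 < z.re} := by
    intro z hz
    have h1 : DifferentiableAt ℂ (mellin g) (-z) :=
      mellin_differentiableAt_of_isBigO_rpow hloc htop (by simpa using hz)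
        (hbot (-z.re - 1)) (by simp)
    exact (differentiableAt_id.mul
      (DifferentiableAt.comp z h1 differentiableAt_id.neg)).differentiableWithinAt
  have hopen : IsOpen {z : ℂ | 0 < z.re} := isOpen_lt continuous_const Complex.continuous_re
  -- Abel summation proves the identity for `Re z > 1`; the identity theorem carries it to `Re z >
  -- 0`.
  have heq : Set.EqOn χ.LFunction (fun z => z * mellin g (-z)) {z : ℂ | 0 < z.re} := by
    refine AnalyticOnNhd.eqOn_of_preconnected_of_eventuallyEq (z₀ := 2)
      ((differentiable_LFunction hχ).differentiableOn.analyticOnNhd hopen)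
      (hdiff.analyticOnNhd hopen) (convex_halfSpace_re_gt 0).isPreconnected (by simp) ?_
    filter_upwards [(isOpen_lt continuous_const Complex.continuous_re).mem_nhds
      (show (2 : ℂ) ∈ {z : ℂ | 1 < z.re} by simp)] with z hz
    have hz : 1 < z.re := hz
    rw [LFunction_eq_LSeries χ hz, hmellin, LSeries_eq_mul_integral _ le_rfl
      (by linarith) (LSeriesSummable_of_one_lt_re χ hz)]
    refine Asymptotics.IsBigO.of_bound P (Eventually.of_forall fun n => ?_)
    simpa using hTP n
  rw [heq (show 0 < w.re by linarith)]
  simp only [hmellin, norm_mul]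
  gcongr
  have hint := integrableOn_Ioi_rpow_of_lt (a := -w.re - 1 / 2) (by linarith) one_pos
  calc _ ≤ ∫ t in Set.Ioi (1 : ℝ), Real.sqrt P * t ^ (-w.re - 1 / 2) := by
        refine norm_integral_le_of_norm_le (hint.const_mul _) ?_
        refine (ae_restrict_iff' measurableSet_Ioi).mpr (Eventually.of_forall fun t ht => ?_)
        have ht : 1 < t := ht
        have ht0 : 0 < t := by linarith
        rw [norm_mul, Complex.norm_cpow_eq_rpow_re_of_pos ht0]
        -- The geometric mean of the bounds `P` and `t` costs only `√P`, at the price of convergence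
        -- requiring `Re w > 1/2`.
        have h1 : ‖T ⌊t⌋₊‖ ≤ Real.sqrt P * Real.sqrt t := by
          rw [← Real.sqrt_mul hP0]
          refine Real.le_sqrt_of_sq_le ?_
          rw [sq]
          exact mul_le_mul (hTP _) ((hTn _).trans (Nat.floor_le ht0.le)) (norm_nonneg _) hP0
        calc _ ≤ Real.sqrt P * Real.sqrt t * t ^ (-(w + 1)).re := by gcongr
          _ = _ := by
            rw [mul_assoc, Real.sqrt_eq_rpow t, ← Real.rpow_add ht0]
            congr 2
            simp
            ring
    _ = Real.sqrt P / (w.re - 1 / 2) := by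
        rw [integral_const_mul, integral_Ioi_rpow_of_lt (by linarith) one_pos, Real.one_rpow,
          div_eq_mul_inv]
        congr 1
        rw [show -w.re - 1 / 2 + 1 = -(w.re - 1 / 2) by ring, inv_neg, neg_one_mul, neg_neg]

theorem Real.exists_one_add_log_le {ε : ℝ} (hε : 0 < ε) :
    ∃ C : ℝ, 0 < C ∧ ∀ x : ℝ, 1 ≤ x → 1 + Real.log x ≤ C * x ^ ε := by
  refine ⟨1 + 1 / ε, by positivity, fun x hx => ?_⟩
  have h1 := Real.log_le_rpow_div (by linarith : 0 ≤ x) hε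
  have h2 := Real.one_le_rpow hx hε.le
  calc 1 + Real.log x ≤ x ^ ε + x ^ ε / ε := add_le_add h2 h1
    _ = _ := by ring

/-- The convexity bound for Dirichlet `L`-functions in the conductor aspect, on bounded sets to
the right of the line `Re w = 1 / 2`. -/
theorem DirichletCharacter.exists_norm_LFunction_le {ε σ R : ℝ} (hε : 0 < ε) (hσ : 1 / 2 < σ) :
    ∃ C : ℝ, 0 < C ∧ ∀ (q : ℕ) [NeZero q] (χ : DirichletCharacter ℂ q), χ ≠ 1 → ∀ w : ℂ,
      σ ≤ w.re → ‖w‖ ≤ R → ‖χ.LFunction w‖ ≤ C * (q : ℝ) ^ (1 / 4 + ε) := by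
  obtain ⟨C₁, hC₁, h₁⟩ := Nat.exists_two_pow_card_primeFactors_le (half_pos hε)
  obtain ⟨C₂, hC₂, h₂⟩ := Real.exists_one_add_log_le (half_pos hε)
  refine ⟨(|R| + 1) * (C₂ / (σ - 1 / 2)) * C₁, ?_, fun q _ χ hχ w hw hwR => ?_⟩
  · have : 0 < σ - 1 / 2 := by linarith
    positivity
  have hσ' : 0 < σ - 1 / 2 := by linarith
  have hw' : 1 / 2 < w.re := by linarith
  have hq0 : 0 < q := Nat.pos_of_ne_zero (NeZero.ne q)
  have hdvd := χ.conductor_dvd_level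
  have hc0 : 0 < χ.conductor := Nat.pos_of_dvd_of_pos hdvd hq0
  have : NeZero χ.conductor := ⟨hc0.ne'⟩
  have hc1 : 1 < χ.conductor := by
    have : χ.conductor ≠ 1 := fun h => hχ (χ.eq_one_iff_conductor_eq_one.mpr h)
    omega
  have hprim : χ.primitiveCharacter ≠ 1 := fun h => hχ <| by
    rw [← χ.changeLevel_primitiveCharacter, h, changeLevel_one]
  have hcq : χ.conductor ≤ q := Nat.le_of_dvd hq0 hdvd
  have hq1 : (1 : ℝ) ≤ q := by exact_mod_cast hq0
  -- Pólya–Vinogradov is applied to the primitive character; the missing Euler factors cost at most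
  -- `2^{ω(q)}`, hence `q^{ε/2}`.
  have hprod : χ.LFunction w = χ.primitiveCharacter.LFunction w *
      ∏ p ∈ q.primeFactors, (1 - χ.primitiveCharacter p * (p : ℂ) ^ (-w)) := by
    conv_lhs => rw [← χ.changeLevel_primitiveCharacter]
    exact LFunction_changeLevel hdvd _ (.inl hprim)
  have hL := norm_LFunction_le_of_norm_sum_le hprim
    (norm_sum_range_le_of_isPrimitive hc1 χ.primitiveCharacter_isPrimitive) hw'
  have hsqrt : Real.sqrt (Real.sqrt χ.conductor * (1 + Real.log χ.conductor)) ≤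
      (q : ℝ) ^ (1 / 4 : ℝ) * (C₂ * (q : ℝ) ^ (ε / 2)) := by
    have hlog : 0 ≤ Real.log q := Real.log_nonneg hq1
    have hc' : (0 : ℝ) < χ.conductor := by exact_mod_cast hc0
    have hcq' : (χ.conductor : ℝ) ≤ q := by exact_mod_cast hcq
    calc _ ≤ Real.sqrt (Real.sqrt q * (1 + Real.log q)) := by
          have := Real.log_le_log hc' hcq'
          have := Real.log_nonneg (show (1 : ℝ) ≤ χ.conductor by exact_mod_cast hc0)
          gcongr
      _ = (q : ℝ) ^ (1 / 4 : ℝ) * Real.sqrt (1 + Real.log q) := by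
          rw [Real.sqrt_mul (Real.sqrt_nonneg _)]
          congr 1
          rw [Real.sqrt_eq_rpow, Real.sqrt_eq_rpow, ← Real.rpow_mul (by positivity)]
          norm_num
      _ ≤ (q : ℝ) ^ (1 / 4 : ℝ) * (1 + Real.log q) := by
          gcongr
          exact Real.sqrt_le_iff.mpr ⟨by linarith, by nlinarith⟩
      _ ≤ _ := by
          gcongr
          exact h₂ q hq1
  calc ‖χ.LFunction w‖ ≤ (‖w‖ * (Real.sqrt (Real.sqrt χ.conductor * (1 + Real.log χ.conductor)) /
          (w.re - 1 / 2))) * 2 ^ q.primeFactors.card := by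
        rw [hprod, norm_mul]
        exact mul_le_mul hL (norm_prod_one_sub_le _ (by linarith)) (norm_nonneg _)
          ((norm_nonneg _).trans hL)
    _ ≤ ((|R| + 1) * (((q : ℝ) ^ (1 / 4 : ℝ) * (C₂ * (q : ℝ) ^ (ε / 2))) / (σ - 1 / 2))) *
          (C₁ * (q : ℝ) ^ (ε / 2)) := by
        gcongr
        · exact hwR.trans ((le_abs_self R).trans (by linarith))
        · exact h₁ q hq0
    _ = (|R| + 1) * (C₂ / (σ - 1 / 2)) * C₁ *
          ((q : ℝ) ^ (1 / 4 : ℝ) * (q : ℝ) ^ (ε / 2) * (q : ℝ) ^ (ε / 2)) := by ring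
    _ = _ := by
        have : (0 : ℝ) < q := by linarith
        rw [← Real.rpow_add this, ← Real.rpow_add this]
        congr 2
        ring

end ConvexityBound

noncomputable section

/-! ### The Kronecker symbol as a quadratic character of its upper argument -/

section KroneckerSymbol

theorem kroneckerSymbol_of_ne_zero (D : ℤ) {n : ℕ} (hn : n ≠ 0) :
    kroneckerSymbol D n = ZMod.χ₈ (D : ZMod 8) ^ n.factorization 2 *
      jacobiSym D (n / 2 ^ n.factorization 2) := if_neg hn

theorem kroneckerSymbol_mul_right (D : ℤ) {m n : ℕ} (hm : m ≠ 0) (hn : n ≠ 0) :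
    kroneckerSymbol D (m * n) = kroneckerSymbol D m * kroneckerSymbol D n := by
  rw [kroneckerSymbol_of_ne_zero D hm, kroneckerSymbol_of_ne_zero D hn,
    kroneckerSymbol_of_ne_zero D (mul_ne_zero hm hn), Nat.ordCompl_mul, Nat.factorization_mul hm hn,
    Finsupp.add_apply, pow_add,
    jacobiSym.mul_right' D (Nat.ordCompl_pos 2 hm).ne' (Nat.ordCompl_pos 2 hn).ne']
  ring

theorem kroneckerSymbol_mul_left (D E : ℤ) {n : ℕ} (hn : n ≠ 0) :
    kroneckerSymbol (D * E) n = kroneckerSymbol D n * kroneckerSymbol E n := by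
  simp only [kroneckerSymbol_of_ne_zero _ hn, jacobiSym.mul_left, Int.cast_mul, map_mul, mul_pow]
  ring

theorem kroneckerSymbol_one_left {n : ℕ} (hn : n ≠ 0) : kroneckerSymbol 1 n = 1 := by
  simp [kroneckerSymbol_of_ne_zero _ hn]

theorem kroneckerSymbol_one_right (D : ℤ) : kroneckerSymbol D 1 = 1 := by
  simp [kroneckerSymbol_of_ne_zero _ one_ne_zero]

theorem kroneckerSymbol_prod_right (D : ℤ) {ι : Type*} (s : Finset ι) (n : ι → ℕ)
    (hn : ∀ i ∈ s, n i ≠ 0) :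
    kroneckerSymbol D (∏ i ∈ s, n i) = ∏ i ∈ s, kroneckerSymbol D (n i) := by
  classical
  induction s using Finset.induction_on with
  | empty => simp [kroneckerSymbol_one_right]
  | insert a s ha ih =>
    rw [Finset.prod_insert ha, Finset.prod_insert ha, kroneckerSymbol_mul_right D
      (hn a (Finset.mem_insert_self _ _))
      (Finset.prod_ne_zero_iff.mpr fun i hi => hn i (Finset.mem_insert_of_mem hi)),
      ih fun i hi => hn i (Finset.mem_insert_of_mem hi)]

/-- The residue modulo `8` controls the power of `2` in `n`, the residue modulo `n` its odd part.
This periodicity makes `d ↦ (d/m)` descend to `ZMod (8 * m)`. -/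
theorem kroneckerSymbol_congr_left {D E : ℤ} {n : ℕ} (hn : n ≠ 0)
    (h8 : D ≡ E [ZMOD 8]) (h : D ≡ E [ZMOD n]) : kroneckerSymbol D n = kroneckerSymbol E n := by
  rw [kroneckerSymbol_of_ne_zero _ hn, kroneckerSymbol_of_ne_zero _ hn,
    (ZMod.intCast_eq_intCast_iff D E 8).mpr h8]
  congr 1
  exact jacobiSym.mod_left' (h.of_dvd (by exact_mod_cast Nat.ordCompl_dvd n 2))

theorem kroneckerSymbol_mem (D : ℤ) {n : ℕ} (hn : n ≠ 0) :
    kroneckerSymbol D n = 0 ∨ kroneckerSymbol D n = 1 ∨ kroneckerSymbol D n = -1 := by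
  have h1 : ∀ k : ℕ, ZMod.χ₈ (D : ZMod 8) ^ k = 0 ∨ ZMod.χ₈ (D : ZMod 8) ^ k = 1 ∨
      ZMod.χ₈ (D : ZMod 8) ^ k = -1 := fun k => by
    rcases ZMod.isQuadratic_χ₈ (D : ZMod 8) with h | h | h <;> rw [h]
    · rcases eq_or_ne k 0 with rfl | hk
      · simp
      · simp [hk]
    · simp
    · exact .inr (neg_one_pow_eq_or ℤ k)
  rw [kroneckerSymbol_of_ne_zero _ hn]
  rcases h1 (n.factorization 2) with h | h | h <;>
    rcases jacobiSym.trichotomy D (n / 2 ^ n.factorization 2) with h' | h' | h' <;>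
    rw [h, h'] <;> decide

theorem norm_kroneckerSymbol_le_one (D : ℤ) {n : ℕ} (hn : n ≠ 0) :
    ‖(kroneckerSymbol D n : ℂ)‖ ≤ 1 := by
  rcases kroneckerSymbol_mem D hn with h | h | h <;> simp [h]

theorem kroneckerSymbol_eq_zero_of_not_coprime {d n : ℕ} (hn : n ≠ 0) (hd : Odd d)
    (h : ¬ d.Coprime n) : kroneckerSymbol (d : ℤ) n = 0 := by
  rw [kroneckerSymbol_of_ne_zero _ hn]
  refine mul_eq_zero_of_right _ (jacobiSym.eq_zero_iff.mpr ⟨(Nat.ordCompl_pos 2 hn).ne', ?_⟩)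
  intro hco
  refine h ?_
  have h1 : d.Coprime (n / 2 ^ n.factorization 2) := by rwa [Int.gcd_natCast_natCast] at hco
  rw [← Nat.ordProj_mul_ordCompl_eq_self n 2]
  exact Nat.Coprime.mul_right ((Nat.coprime_two_right.mpr hd).pow_right _) h1

theorem ZMod.χ₈_natCast_eq_zero {d : ℕ} (hd : ¬ Odd d) : ZMod.χ₈ (d : ZMod 8) = 0 := by
  refine MulChar.map_nonunit _ fun h => hd ?_
  have := (ZMod.isUnit_iff_coprime d 8).mp h
  exact Nat.coprime_two_right.mp (this.of_dvd_right (by norm_num))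

theorem ZMod.χ₈_natCast_sq {d : ℕ} (hd : Odd d) : ZMod.χ₈ (d : ZMod 8) ^ 2 = 1 := by
  have hu : IsUnit (d : ZMod 8) := (ZMod.isUnit_iff_coprime d 8).mpr
    ((Nat.coprime_two_right.mpr hd).pow_right 3)
  have h0 : ZMod.χ₈ (d : ZMod 8) ≠ 0 := (hu.map ZMod.χ₈).ne_zero
  rcases ZMod.isQuadratic_χ₈ (d : ZMod 8) with h | h | h
  · exact absurd h h0
  · simp [h]
  · simp [h]

/-- The odd part of `d ↦ χ₄(d) ^ e (d / m)`, as a character modulo `8 m`. -/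
def kroneckerChar (e m : ℕ) [NeZero m] : DirichletCharacter ℂ (8 * m) where
  -- The square of `χ₈` is the indicator of odd residues. It is needed for vanishing on nonunits:
  -- for odd `m` and `e = 0` the other factors need not vanish at even `x`.
  toFun x := ((ZMod.χ₈ (x.val : ZMod 8) ^ 2 * ZMod.χ₄ (x.val : ZMod 4) ^ e *
    kroneckerSymbol (x.val : ℤ) m : ℤ) : ℂ)
  map_one' := by
    have : (1 : ZMod (8 * m)).val = 1 := by
      have h1 : 1 < 8 * m := by have := NeZero.pos m; omega
      have := Fact.mk h1
      exact ZMod.val_one _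
    rw [this]
    simp [kroneckerSymbol_one_left (NeZero.ne m)]
  map_mul' x y := by
    have h8 : (((x * y).val : ℕ) : ZMod 8) = (x.val : ZMod 8) * (y.val : ZMod 8) := by
      rw [ZMod.val_mul, ← Nat.cast_mul, ZMod.natCast_eq_natCast_iff]
      exact (Nat.mod_modEq _ _).of_dvd (Nat.dvd_mul_right 8 m)
    have h4 : (((x * y).val : ℕ) : ZMod 4) = (x.val : ZMod 4) * (y.val : ZMod 4) := by
      rw [ZMod.val_mul, ← Nat.cast_mul, ZMod.natCast_eq_natCast_iff]
      exact (Nat.mod_modEq _ _).of_dvd (Dvd.dvd.mul_right (by norm_num) m)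
    have hk : kroneckerSymbol (((x * y).val : ℕ) : ℤ) m =
        kroneckerSymbol (x.val : ℤ) m * kroneckerSymbol (y.val : ℤ) m := by
      rw [← kroneckerSymbol_mul_left _ _ (NeZero.ne m), ← Nat.cast_mul, ZMod.val_mul]
      refine kroneckerSymbol_congr_left (NeZero.ne m) ?_ ?_
      · exact (Int.natCast_modEq_iff (n := 8)).mpr
          ((Nat.mod_modEq _ _).of_dvd (Nat.dvd_mul_right 8 m))
      · exact Int.natCast_modEq_iff.mpr ((Nat.mod_modEq _ _).of_dvd (Nat.dvd_mul_left m 8))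
    rw [h8, h4, hk, map_mul, map_mul, ← Int.cast_mul]
    congr 1
    ring
  map_nonunit' x hx := by
    have hx' : ¬ x.val.Coprime (8 * m) := fun h => hx <| by
      simpa using (ZMod.isUnit_iff_coprime x.val (8 * m)).mpr h
    by_cases hodd : Odd x.val
    · have : ¬ x.val.Coprime m := fun h => hx' <|
        Nat.Coprime.mul_right ((Nat.coprime_two_right.mpr hodd).pow_right 3) h
      rw [kroneckerSymbol_eq_zero_of_not_coprime (NeZero.ne m) hodd this]
      simp
    · rw [ZMod.χ₈_natCast_eq_zero hodd]
      simp

theorem kroneckerChar_natCast (e m : ℕ) [NeZero m] (d : ℕ) :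
    kroneckerChar e m (d : ZMod (8 * m)) = ((ZMod.χ₈ (d : ZMod 8) ^ 2 *
      ZMod.χ₄ (d : ZMod 4) ^ e * kroneckerSymbol (d : ℤ) m : ℤ) : ℂ) := by
  change ((ZMod.χ₈ (((d : ZMod (8 * m)).val : ℕ) : ZMod 8) ^ 2 *
    ZMod.χ₄ (((d : ZMod (8 * m)).val : ℕ) : ZMod 4) ^ e *
    kroneckerSymbol (((d : ZMod (8 * m)).val : ℕ) : ℤ) m : ℤ) : ℂ) = _
  rw [ZMod.val_natCast]
  have h8 : ((d % (8 * m) : ℕ) : ZMod 8) = d := by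
    rw [ZMod.natCast_eq_natCast_iff]
    exact (Nat.mod_modEq _ _).of_dvd (Nat.dvd_mul_right 8 m)
  have h4 : ((d % (8 * m) : ℕ) : ZMod 4) = d := by
    rw [ZMod.natCast_eq_natCast_iff]
    exact (Nat.mod_modEq _ _).of_dvd (Dvd.dvd.mul_right (by norm_num) m)
  have hk : kroneckerSymbol ((d % (8 * m) : ℕ) : ℤ) m = kroneckerSymbol (d : ℤ) m := by
    refine kroneckerSymbol_congr_left (NeZero.ne m) ?_ ?_
    · exact (Int.natCast_modEq_iff (n := 8)).mpr
        ((Nat.mod_modEq _ _).of_dvd (Nat.dvd_mul_right 8 m))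
    · exact Int.natCast_modEq_iff.mpr ((Nat.mod_modEq _ _).of_dvd (Nat.dvd_mul_left m 8))
  rw [h8, h4, hk]

theorem kroneckerChar_natCast_of_even (e m : ℕ) [NeZero m] {d : ℕ} (hd : ¬ Odd d) :
    kroneckerChar e m (d : ZMod (8 * m)) = 0 := by
  rw [kroneckerChar_natCast, ZMod.χ₈_natCast_eq_zero hd]
  simp

theorem kroneckerChar_natCast_of_odd (e m : ℕ) [NeZero m] {d : ℕ} (hd : Odd d) :
    kroneckerChar e m (d : ZMod (8 * m)) =
      ((ZMod.χ₄ (d : ZMod 4) ^ e * kroneckerSymbol (d : ℤ) m : ℤ) : ℂ) := by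
  rw [kroneckerChar_natCast, ZMod.χ₈_natCast_sq hd, one_mul]

theorem kroneckerChar_sq (e m : ℕ) [NeZero m] : kroneckerChar e m ^ 2 = 1 := by
  refine MulChar.ext fun u => ?_
  rw [MulChar.pow_apply_coe, MulChar.one_apply_coe]
  have h0 : kroneckerChar e m u ≠ 0 := (u.isUnit.map (kroneckerChar e m)).ne_zero
  have hu : ((u : ZMod (8 * m)).val : ZMod (8 * m)) = u := ZMod.natCast_zmod_val _
  rw [← hu] at h0 ⊢
  have hodd : Odd (u : ZMod (8 * m)).val := by
    by_contra h
    exact h0 (kroneckerChar_natCast_of_even e m h)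
  rw [kroneckerChar_natCast_of_odd e m hodd] at h0 ⊢
  have hx : ∀ x : ℤ, x = 0 ∨ x = 1 ∨ x = -1 → ((x ^ e : ℤ) = 0 ∨ x ^ e = 1 ∨ x ^ e = -1) := by
    rintro x (rfl | rfl | rfl)
    · rcases eq_or_ne e 0 with rfl | he
      · simp
      · simp [he]
    · simp
    · exact .inr (neg_one_pow_eq_or ℤ e)
  rcases hx _ (ZMod.isQuadratic_χ₄ ((u : ZMod (8 * m)).val : ZMod 4)) with h | h | h <;>
    rcases kroneckerSymbol_mem (((u : ZMod (8 * m)).val : ℕ) : ℤ) (NeZero.ne m)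
      with h' | h' | h' <;>
    rw [h, h'] at h0 ⊢ <;> simp at h0 ⊢

/-- Some prime `p` divides `n` to an odd power. By the Chinese remainder theorem take `D` a
nonresidue modulo `p` and `1` modulo the prime-to-`p` part of `n`. -/
theorem jacobiSym.exists_eq_neg_one {n : ℕ} (hn : Odd n) (hsq : ¬ IsSquare n) :
    ∃ D : ℕ, jacobiSym (D : ℤ) n = -1 := by
  have hn0 : n ≠ 0 := by rintro rfl; simp at hn
  obtain ⟨p, hp, he⟩ : ∃ p, p.Prime ∧ Odd (n.factorization p) := by
    by_contra! h
    refine hsq ⟨∏ p ∈ n.primeFactors, p ^ (n.factorization p / 2), ?_⟩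
    rw [← Finset.prod_mul_distrib]
    conv_lhs => rw [← Nat.prod_factorization_pow_eq_self hn0]
    refine Finset.prod_congr rfl fun p hp => ?_
    have := Nat.not_odd_iff_even.mp (h p (Nat.prime_of_mem_primeFactors hp))
    rw [← pow_add]
    congr 1
    obtain ⟨r, hr⟩ := this
    omega
  have := Fact.mk hp
  have hp2 : p ≠ 2 := by
    rintro rfl
    have : n.factorization 2 = 0 := Nat.factorization_eq_zero_of_not_dvd fun h => by
      obtain ⟨c, hc⟩ := h
      exact Nat.not_even_iff_odd.mpr hn ⟨c, by omega⟩
    rw [this] at he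
    simp at he
  obtain ⟨u, hu⟩ := FiniteField.exists_nonsquare (F := ZMod p) (by rwa [ZMod.ringChar_zmod_n])
  have hco : Nat.Coprime p (n / p ^ n.factorization p) := Nat.coprime_ordCompl hp hn0
  obtain ⟨D, hD1, hD2⟩ := Nat.chineseRemainder hco u.val 1
  refine ⟨D, ?_⟩
  have hn' : n = p ^ n.factorization p * (n / p ^ n.factorization p) :=
    (Nat.ordProj_mul_ordCompl_eq_self n p).symm
  rw [hn', jacobiSym.mul_right' _ (pow_ne_zero _ hp.ne_zero) (Nat.ordCompl_pos p hn0).ne',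
    jacobiSym.pow_right]
  have h1 : jacobiSym (D : ℤ) (n / p ^ n.factorization p) = 1 := by
    rw [jacobiSym.mod_left' (a₂ := 1) (by exact_mod_cast hD2), jacobiSym.one_left]
  have h2 : jacobiSym (D : ℤ) p = -1 := by
    refine ZMod.nonsquare_iff_jacobiSym_eq_neg_one.mpr ?_
    have : ((D : ℤ) : ZMod p) = u := by
      rw [Int.cast_natCast, (ZMod.natCast_eq_natCast_iff _ _ _).mpr hD1, ZMod.natCast_zmod_val]
    rwa [this]
  rw [h1, h2, he.neg_one_pow, mul_one]

/-- The residue `r` modulo `8` and the residue `D` modulo the odd part of `m` can be prescribed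
independently, and the trivial character never takes the value `-1`. -/
theorem kroneckerChar_ne_one_of_eq_neg_one {e m : ℕ} [NeZero m] (r D : ℕ)
    (h : ZMod.χ₈ (r : ZMod 8) ^ 2 * ZMod.χ₄ (r : ZMod 4) ^ e *
      (ZMod.χ₈ (r : ZMod 8) ^ m.factorization 2 * jacobiSym D (m / 2 ^ m.factorization 2)) = -1) :
    kroneckerChar e m ≠ 1 := by
  intro h1
  have hm : m ≠ 0 := NeZero.ne m
  have hco : Nat.Coprime 8 (m / 2 ^ m.factorization 2) :=
    (Nat.coprime_ordCompl Nat.prime_two hm).pow_left 3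
  obtain ⟨E, hE1, hE2⟩ := Nat.chineseRemainder hco r D
  have hval : kroneckerChar e m (E : ZMod (8 * m)) = -1 := by
    rw [kroneckerChar_natCast, kroneckerSymbol_of_ne_zero _ hm, Int.cast_natCast,
      (ZMod.natCast_eq_natCast_iff _ _ _).mpr hE1,
      (ZMod.natCast_eq_natCast_iff E r 4).mpr (hE1.of_dvd (by norm_num)),
      jacobiSym.mod_left' (a₂ := D) (by exact_mod_cast hE2), h]
    simp
  rw [h1] at hval
  by_cases hu : IsUnit (E : ZMod (8 * m))
  · rw [MulChar.one_apply hu] at hval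
    norm_num at hval
  · rw [MulChar.map_nonunit _ hu] at hval
    norm_num at hval

theorem isSquare_ordCompl_two_or_exists_jacobiSym_eq_neg_one {m : ℕ} (hm : m ≠ 0) :
    IsSquare (m / 2 ^ m.factorization 2) ∨
      ∃ D : ℕ, jacobiSym (D : ℤ) (m / 2 ^ m.factorization 2) = -1 := by
  by_cases h : IsSquare (m / 2 ^ m.factorization 2)
  · exact .inl h
  · exact .inr (jacobiSym.exists_eq_neg_one
      (Nat.coprime_two_left.mp (Nat.coprime_ordCompl Nat.prime_two hm)) h)

theorem kroneckerChar_one_ne_one (m : ℕ) [NeZero m] : kroneckerChar 1 m ≠ 1 := by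
  rcases isSquare_ordCompl_two_or_exists_jacobiSym_eq_neg_one (NeZero.ne m) with h | ⟨D, hD⟩
  -- The class `7` is invisible to `χ₈` but detected by `χ₄`.
  · refine kroneckerChar_ne_one_of_eq_neg_one 7 1 ?_
    have h8 : ZMod.χ₈ ((7 : ℕ) : ZMod 8) = 1 := by decide
    have h4 : ZMod.χ₄ ((7 : ℕ) : ZMod 4) = -1 := by decide
    rw [h8, h4]
    simp
  · refine kroneckerChar_ne_one_of_eq_neg_one 1 D ?_
    simp [hD]

theorem kroneckerChar_zero_ne_one {m : ℕ} [NeZero m] (hsq : ¬ IsSquare m) :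
    kroneckerChar 0 m ≠ 1 := by
  rcases isSquare_ordCompl_two_or_exists_jacobiSym_eq_neg_one (NeZero.ne m) with h | ⟨D, hD⟩
  · have hodd : Odd (m.factorization 2) := by
      by_contra heven
      refine hsq ?_
      rw [← Nat.ordProj_mul_ordCompl_eq_self m 2]
      exact ((Nat.not_odd_iff_even.mp heven).isSquare_pow 2).mul h
    -- Here `m` is a square times an odd power of `2`, so a class with `χ₈ = -1` suffices.
    refine kroneckerChar_ne_one_of_eq_neg_one 5 1 ?_
    have h8 : ZMod.χ₈ ((5 : ℕ) : ZMod 8) = -1 := by decide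
    rw [h8, hodd.neg_one_pow]
    simp
  · refine kroneckerChar_ne_one_of_eq_neg_one 1 D ?_
    simp [hD]

theorem kroneckerChar_zero_eq_one {m : ℕ} [NeZero m] (hsq : IsSquare m) :
    kroneckerChar 0 m = 1 := by
  refine MulChar.ext fun u => ?_
  rw [MulChar.one_apply_coe]
  have h0 : kroneckerChar 0 m u ≠ 0 := (u.isUnit.map (kroneckerChar 0 m)).ne_zero
  have hu : ((u : ZMod (8 * m)).val : ZMod (8 * m)) = u := ZMod.natCast_zmod_val _
  rw [← hu] at h0 ⊢
  have hodd : Odd (u : ZMod (8 * m)).val := by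
    by_contra h
    exact h0 (kroneckerChar_natCast_of_even 0 m h)
  rw [kroneckerChar_natCast_of_odd 0 m hodd] at h0 ⊢
  obtain ⟨r, rfl⟩ := hsq
  have hr : r ≠ 0 := by
    rintro rfl
    exact NeZero.ne (0 * 0) (mul_zero 0)
  rw [kroneckerSymbol_mul_right _ hr hr] at h0 ⊢
  rcases kroneckerSymbol_mem (((u : ZMod (8 * (r * r))).val : ℕ) : ℤ) hr with h' | h' | h' <;>
    rw [h'] at h0 ⊢ <;> simp at h0 ⊢

end KroneckerSymbol

/-! ### Quadratic characters summed over squarefree integers -/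

section SquarefreeSums

open ArithmeticFunction
open scoped LSeries.notation Moebius

/-- The Dirichlet series of a quadratic character over the squarefree integers. -/
theorem DirichletCharacter.hasSum_squarefree {q : ℕ} [NeZero q] {χ : DirichletCharacter ℂ q}
    (hχ : χ ^ 2 = 1) {w : ℂ} (hw : 1 < w.re) :
    HasSum (fun d : ℕ => if Squarefree d then χ d * (d : ℂ) ^ (-w) else 0)
      (χ.LFunction w * L (↗(1 : DirichletCharacter ℂ q) * ↗μ) (2 * w)) := by
  set f : ℕ → ℂ := fun d => if Squarefree d then χ d * (d : ℂ) ^ (-w) else 0 with hf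
  have hw0 : w ≠ 0 := fun h => by simp [h] at hw; linarith
  have h2w : 1 < (2 * w).re := by
    simp; linarith
  have hsum : Summable fun d => ‖f d‖ := by
    refine Summable.of_nonneg_of_le (fun _ => norm_nonneg _) (fun d => ?_)
      (Real.summable_nat_rpow.mpr (show -w.re < -1 by linarith))
    by_cases hd : Squarefree d
    · simp only [hf, if_pos hd, norm_mul]
      rw [Complex.norm_natCast_cpow_of_pos (Nat.pos_of_ne_zero hd.ne_zero), Complex.neg_re]
      exact mul_le_of_le_one_left (by positivity) (χ.norm_le_one _)
    · simp only [hf, if_neg hd, norm_zero]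
      positivity
  have hf1 : f 1 = 1 := by simp [hf]
  have hf0 : f 0 = 0 := by simp [hf]
  have hmul : ∀ {m n : ℕ}, m.Coprime n → f (m * n) = f m * f n := fun {m n} hmn => by
    simp only [hf, Nat.squarefree_mul hmn]
    by_cases h1 : Squarefree m <;> by_cases h2 : Squarefree n <;> simp [h1, h2]
    rw [Complex.natCast_mul_natCast_cpow]
    ring
  have hprod := EulerProduct.eulerProduct_hasProd hf1 hmul hsum hf0
  have hloc : ∀ p : Nat.Primes, ∑' e, f ((p : ℕ) ^ e) = 1 + χ (p : ℕ) * ((p : ℕ) : ℂ) ^ (-w) := by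
    intro p
    rw [tsum_eq_sum (s := Finset.range 2)]
    · simp [Finset.sum_range_succ, hf, p.2.prime.squarefree]
    · intro e he
      have he : 1 < e := by simpa using he
      have : ¬ Squarefree ((p : ℕ) ^ e) := fun h => by
        rcases (Nat.squarefree_pow_iff p.2.ne_one (by omega)).mp h with ⟨_, h⟩
        omega
      simp [hf, this]
  simp_rw [hloc] at hprod
  have hprod2 := hprod.mul ((1 : DirichletCharacter ℂ q).LSeries_eulerProduct_hasProd h2w)
  have hprodL := χ.LSeries_eulerProduct_hasProd hw
  -- The local identity `(1 + x) / (1 - x²) = 1 / (1 - x)`, where `χ² = 1` identifies `x²` with the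
  -- local term of `L(2w, 1)`. The factor `L(2w, 1)` is then inverted by the Möbius series.
  have hEq : (fun p : Nat.Primes => (1 + χ (p : ℕ) * ((p : ℕ) : ℂ) ^ (-w)) *
      (1 - (1 : DirichletCharacter ℂ q) (p : ℕ) * ((p : ℕ) : ℂ) ^ (-(2 * w)))⁻¹) =
      fun p : Nat.Primes => (1 - χ (p : ℕ) * ((p : ℕ) : ℂ) ^ (-w))⁻¹ := by
    funext p
    have hp0 : ((p : ℕ) : ℂ) ≠ 0 := by exact_mod_cast p.2.ne_zero
    have hlt : ‖χ (p : ℕ) * ((p : ℕ) : ℂ) ^ (-w)‖ < 1 := by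
      rw [norm_mul, Complex.norm_natCast_cpow_of_pos p.2.pos, Complex.neg_re]
      refine (mul_le_of_le_one_left (by positivity) (χ.norm_le_one _)).trans_lt ?_
      exact Real.rpow_lt_one_of_one_lt_of_neg (by exact_mod_cast p.2.one_lt) (by linarith)
    set x := χ (p : ℕ) * ((p : ℕ) : ℂ) ^ (-w) with hx
    have e1 : (1 : DirichletCharacter ℂ q) (p : ℕ) * ((p : ℕ) : ℂ) ^ (-(2 * w)) = x ^ 2 := by
      rw [← hχ, MulChar.pow_apply' _ two_ne_zero, hx, mul_pow, ← Complex.cpow_nat_mul]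
      congr 2
      push_cast
      ring
    have hm : 1 - x ≠ 0 := fun h => by
      rw [← sub_eq_zero.mp h] at hlt
      simp at hlt
    have hpl : 1 + x ≠ 0 := fun h => by
      have : x = -1 := by linear_combination h
      rw [this] at hlt
      simp at hlt
    rw [e1, show 1 - x ^ 2 = (1 - x) * (1 + x) by ring]
    field_simp
  rw [hEq] at hprod2
  have hval := hprod2.unique hprodL
  have hmu := DirichletCharacter.LSeries.mul_mu_eq_one (1 : DirichletCharacter ℂ q) h2w
  have : ∑' n, f n = χ.LFunction w * L (↗(1 : DirichletCharacter ℂ q) * ↗μ) (2 * w) := by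
    rw [LFunction_eq_LSeries χ hw, ← hval, mul_assoc, hmu, mul_one]
  rw [← this]
  exact hsum.of_norm.hasSum

theorem norm_one_mul_moebius_le (q n : ℕ) :
    ‖(↗(1 : DirichletCharacter ℂ q) * ↗μ) n‖ ≤ 1 := by
  rw [Pi.mul_apply, norm_mul]
  refine mul_le_one₀ (DirichletCharacter.norm_le_one _ _) (norm_nonneg _) ?_
  rw [Complex.norm_intCast]
  exact_mod_cast abs_moebius_le_one

theorem differentiableAt_LSeries_one_mul_moebius (q : ℕ) {s : ℂ} (hs : 1 < s.re) :
    DifferentiableAt ℂ (L (↗(1 : DirichletCharacter ℂ q) * ↗μ)) s := by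
  refine (LSeries_hasDerivAt (lt_of_le_of_lt
    (LSeries.abscissaOfAbsConv_le_of_le_const ⟨1, fun n _ => norm_one_mul_moebius_le q n⟩)
    ?_)).differentiableAt
  exact_mod_cast hs

theorem norm_LSeries_one_mul_moebius_le (q : ℕ) {σ : ℝ} (hσ : 1 < σ) {s : ℂ} (hs : σ ≤ s.re) :
    ‖L (↗(1 : DirichletCharacter ℂ q) * ↗μ) s‖ ≤ ∑' n : ℕ, (n : ℝ) ^ (-σ) := by
  refine tsum_of_norm_bounded (Real.summable_nat_rpow.mpr (by linarith)).hasSum fun n => ?_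
  rw [LSeries.norm_term_eq]
  split_ifs with hn
  · positivity
  · have hn1 : (1 : ℝ) ≤ n := by exact_mod_cast Nat.pos_of_ne_zero hn
    rw [Real.rpow_neg (by positivity), div_eq_mul_inv]
    refine (mul_le_of_le_one_left (by positivity) (norm_one_mul_moebius_le q n)).trans ?_
    exact inv_anti₀ (by positivity) (Real.rpow_le_rpow_of_exponent_le hn1 hs)

end SquarefreeSums

/-! ### The series over fundamental discriminants: continuation, growth and value at `w = 1` -/

section FundamentalDiscriminants

open scoped LSeries.notation ArithmeticFunction.Moebius

theorem mem_posFundDisc_of_odd {d : ℕ} (hd : Odd d) :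
    d ∈ posFundDisc ↔ Squarefree d ∧ d % 4 = 1 := by
  obtain ⟨k, hk⟩ := hd
  constructor
  · rintro ⟨_, ⟨h1, h2⟩ | ⟨h1, _⟩⟩
    · exact ⟨Int.squarefree_natCast.mp h2, by omega⟩
    · omega
  · rintro ⟨h1, h2⟩
    exact ⟨by omega, .inl ⟨by omega, Int.squarefree_natCast.mpr h1⟩⟩

theorem notMem_posFundDisc_of_mod_four_eq_two {d : ℕ} (hd : d % 4 = 2) : d ∉ posFundDisc := by
  rintro ⟨_, ⟨h1, _⟩ | ⟨h1, _⟩⟩ <;> omega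

theorem four_mul_mem_posFundDisc {d : ℕ} (hd : Odd d) :
    4 * d ∈ posFundDisc ↔ Squarefree d ∧ d % 4 = 3 := by
  have hdiv : ((4 * d : ℕ) : ℤ) / 4 = d := by omega
  obtain ⟨k, hk⟩ := hd
  constructor
  · rintro ⟨_, ⟨h1, _⟩ | ⟨_, h2, h3⟩⟩
    · omega
    · rw [hdiv] at h2 h3
      exact ⟨Int.squarefree_natCast.mp h3, by omega⟩
  · rintro ⟨h1, h2⟩
    refine ⟨by omega, .inr ⟨by omega, ?_, ?_⟩⟩ <;> rw [hdiv]
    · omega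
    · exact Int.squarefree_natCast.mpr h1

theorem eight_mul_mem_posFundDisc {d : ℕ} :
    8 * d ∈ posFundDisc ↔ Squarefree d ∧ Odd d := by
  have hdiv : ((8 * d : ℕ) : ℤ) / 4 = ((2 * d : ℕ) : ℤ) := by omega
  constructor
  · rintro ⟨_, ⟨h1, _⟩ | ⟨_, h2, h3⟩⟩
    · omega
    · rw [hdiv] at h2 h3
      refine ⟨(Int.squarefree_natCast.mp h3).squarefree_of_dvd (Nat.dvd_mul_left d 2), ?_⟩
      rw [Nat.odd_iff]
      omega
  · rintro ⟨h1, h2⟩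
    have hd : d % 2 = 1 := Nat.odd_iff.mp h2
    refine ⟨by omega, .inr ⟨by omega, ?_, ?_⟩⟩ <;> rw [hdiv]
    · omega
    · exact Int.squarefree_natCast.mpr ((Nat.squarefree_mul (Nat.coprime_two_left.mpr h2)).mpr
        ⟨Nat.prime_two.squarefree, h1⟩)

/-- The series `∑ χ_d(m) d ^ (-w)` over the positive fundamental discriminants, in terms of the
`L`-functions of characters modulo `8 m`. -/
theorem hasSum_kroneckerSymbol_posFundDisc (m : ℕ) [NeZero m] {w : ℂ} (hw : 1 < w.re) :
    HasSum (fun d : posFundDisc => (kroneckerSymbol (d : ℕ) m : ℂ) * ((d : ℕ) : ℂ) ^ (-w))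
      (((1 / 2 + (kroneckerSymbol 4 m : ℂ) * 4 ^ (-w) / 2 + (kroneckerSymbol 8 m : ℂ) * 8 ^ (-w)) *
          (kroneckerChar 0 m).LFunction w +
        (1 / 2 - (kroneckerSymbol 4 m : ℂ) * 4 ^ (-w) / 2) * (kroneckerChar 1 m).LFunction w) *
        L (↗(1 : DirichletCharacter ℂ (8 * m)) * ↗μ) (2 * w)) := by
  set u : ℕ → ℕ → ℂ := fun e d =>
    if Squarefree d then kroneckerChar e m d * (d : ℂ) ^ (-w) else 0 with hu
  set R := L (↗(1 : DirichletCharacter ℂ (8 * m)) * ↗μ) (2 * w) with hR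
  have hm : m ≠ 0 := NeZero.ne m
  have hB : ∀ e, HasSum (u e) ((kroneckerChar e m).LFunction w * R) := fun e =>
    DirichletCharacter.hasSum_squarefree (kroneckerChar_sq e m) hw
  set c₄ : ℂ := (kroneckerSymbol 4 m : ℂ) * 4 ^ (-w) with hc₄
  set c₈ : ℂ := (kroneckerSymbol 8 m : ℂ) * 8 ^ (-w) with hc₈
  have hi4 : Function.Injective fun d : ℕ => 4 * d := fun a b h => by
    simpa using h
  have hi8 : Function.Injective fun d : ℕ => 8 * d := fun a b h => by
    simpa using h
  -- Because `u 1 = ± u 0` according to the class modulo `4`, the half sum selects `d ≡ 1`, and the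
  -- half difference selects `b ≡ 3` for `d = 4b`. The third series covers `d = 8b` with `b` odd.
  have h1 := ((hB 0).add (hB 1)).mul_left (1 / 2)
  have h2 := (hasSum_extend_zero hi4).mpr (((hB 0).sub (hB 1)).mul_left (c₄ / 2))
  have h3 := (hasSum_extend_zero hi8).mpr ((hB 0).mul_left c₈)
  have hueven : ∀ e d, ¬ Odd d → u e d = 0 := fun e d hd => by
    simp [hu, kroneckerChar_natCast_of_even e m hd]
  have hu0 : ∀ d, Odd d → Squarefree d →
      u 0 d = (kroneckerSymbol (d : ℕ) m : ℂ) * (d : ℂ) ^ (-w) := fun d hd hsq => by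
    simp [hu, hsq, kroneckerChar_natCast_of_odd 0 m hd]
  have hu1 : ∀ d, Odd d → d % 4 = 1 → u 1 d = u 0 d := fun d hd hd1 => by
    simp only [hu, kroneckerChar_natCast_of_odd _ m hd, ZMod.χ₄_nat_one_mod_four hd1]
    simp
  have hu3 : ∀ d, Odd d → d % 4 = 3 → u 1 d = - u 0 d := fun d hd hd1 => by
    simp only [hu, kroneckerChar_natCast_of_odd _ m hd, ZMod.χ₄_nat_three_mod_four hd1]
    split_ifs <;> simp
  have husq : ∀ e d, ¬ Squarefree d → u e d = 0 := fun e d hd => by simp [hu, hd]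
  have hx4 : ∀ d : ℕ, ¬ 4 ∣ d → Function.extend (fun d : ℕ => 4 * d)
      (fun b => c₄ / 2 * (u 0 b - u 1 b)) 0 d = 0 := fun d hd =>
    Function.extend_apply' _ _ _ fun ⟨a, ha⟩ => hd ⟨a, ha.symm⟩
  have hx8 : ∀ d : ℕ, ¬ 8 ∣ d → Function.extend (fun d : ℕ => 8 * d)
      (fun b => c₈ * u 0 b) 0 d = 0 := fun d hd =>
    Function.extend_apply' _ _ _ fun ⟨a, ha⟩ => hd ⟨a, ha.symm⟩
  have hcp : ∀ c d : ℕ, (kroneckerSymbol ((c * d : ℕ) : ℤ) m : ℂ) * ((c * d : ℕ) : ℂ) ^ (-w) =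
      ((kroneckerSymbol (c : ℤ) m : ℂ) * (c : ℂ) ^ (-w)) *
        ((kroneckerSymbol (d : ℤ) m : ℂ) * (d : ℂ) ^ (-w)) := fun c d => by
    rw [Nat.cast_mul, kroneckerSymbol_mul_left _ _ hm, Nat.cast_mul,
      Complex.natCast_mul_natCast_cpow]
    push_cast
    ring
  have hall := (h1.add h2).add h3
  have hfun : (posFundDisc.indicator
      fun d : ℕ => (kroneckerSymbol (d : ℤ) m : ℂ) * (d : ℂ) ^ (-w)) = fun d =>
      1 / 2 * (u 0 d + u 1 d) + Function.extend (fun d : ℕ => 4 * d)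
        (fun b => c₄ / 2 * (u 0 b - u 1 b)) 0 d +
        Function.extend (fun d : ℕ => 8 * d) (fun b => c₈ * u 0 b) 0 d := by
    funext d
    rcases Nat.even_or_odd d with hev | hodd
    swap
    · have hd2 : d % 2 = 1 := Nat.odd_iff.mp hodd
      rw [hx4 d (by omega), hx8 d (by omega)]
      by_cases hsq : Squarefree d
      · rcases (by omega : d % 4 = 1 ∨ d % 4 = 3) with h | h
        · rw [Set.indicator_of_mem ((mem_posFundDisc_of_odd hodd).mpr ⟨hsq, h⟩), hu1 d hodd h,
            hu0 d hodd hsq]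
          ring
        · rw [Set.indicator_of_notMem (fun h' => by
            have := ((mem_posFundDisc_of_odd hodd).mp h').2; omega), hu3 d hodd h]
          ring
      · rw [Set.indicator_of_notMem (fun h' => hsq ((mem_posFundDisc_of_odd hodd).mp h').1),
          husq _ _ hsq, husq _ _ hsq]
        ring
    · have hnd : ¬ Odd d := Nat.not_odd_iff_even.mpr hev
      have hd2 : d % 2 = 0 := Nat.even_iff.mp hev
      rw [hueven 0 d hnd, hueven 1 d hnd]
      by_cases h4 : 4 ∣ d
      swap
      · rw [hx4 d h4, hx8 d (fun h => h4 (by omega)), Set.indicator_of_notMem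
          (notMem_posFundDisc_of_mod_four_eq_two (by omega))]
        ring
      by_cases h8 : 8 ∣ d
      · obtain ⟨b, rfl⟩ := h8
        -- A multiple of `8` also lies in the range of `4 * ·`, as `4 * (2 * b)`; that contribution
        -- vanishes because `2 * b` is even.
        have e4 := hi4.extend_apply (fun b => c₄ / 2 * (u 0 b - u 1 b)) 0 (2 * b)
        have e8 := hi8.extend_apply (fun b => c₈ * u 0 b) 0 b
        simp only [← mul_assoc] at e4 e8
        norm_num only at e4
        rw [e4, e8, hueven 0 (2 * b) (by simp), hueven 1 (2 * b) (by simp)]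
        by_cases hb : Squarefree b ∧ Odd b
        · rw [Set.indicator_of_mem (eight_mul_mem_posFundDisc.mpr hb), hcp,
            hu0 b hb.2 hb.1, hc₈]
          push_cast
          ring
        · rw [Set.indicator_of_notMem (fun h => hb (eight_mul_mem_posFundDisc.mp h))]
          have : u 0 b = 0 := by
            by_cases h : Odd b
            · exact husq 0 b fun h' => hb ⟨h', h⟩
            · exact hueven 0 b h
          rw [this]
          ring
      · rw [hx8 d h8]
        obtain ⟨b, rfl⟩ := h4
        have hb : Odd b := by
          rw [Nat.odd_iff]; omega
        have hb2 := Nat.odd_iff.mp hb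
        rw [hi4.extend_apply (fun b => c₄ / 2 * (u 0 b - u 1 b)) 0 b]
        by_cases hsq : Squarefree b
        · rcases (by omega : b % 4 = 1 ∨ b % 4 = 3) with h | h
          · rw [Set.indicator_of_notMem (fun h' => by
              have := ((four_mul_mem_posFundDisc hb).mp h').2; omega), hu1 b hb h]
            ring
          · rw [Set.indicator_of_mem ((four_mul_mem_posFundDisc hb).mpr ⟨hsq, h⟩), hcp,
              hu3 b hb h, hu0 b hb hsq, hc₄]
            push_cast
            ring
        · rw [Set.indicator_of_notMem (fun h' => hsq ((four_mul_mem_posFundDisc hb).mp h').1),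
            husq _ _ hsq, husq _ _ hsq]
          ring
  rw [← hfun] at hall
  have := (hasSum_subtype_iff_indicator (s := posFundDisc)
    (f := fun d : ℕ => (kroneckerSymbol (d : ℤ) m : ℂ) * (d : ℂ) ^ (-w))).mpr hall
  rw [show ∀ x y z a b : ℂ, ((1 / 2 + x / 2 + y) * a + (1 / 2 - x / 2) * b) * z =
    1 / 2 * (a * z + b * z) + x / 2 * (a * z - b * z) + y * (a * z) from fun _ _ _ _ _ => by ring]
  exact this

/-- The holomorphic continuation to `Re w > 1 / 2` of `(w - 1) ∑ χ_d(m) d ^ (-w)`, where `d` runs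
over the positive fundamental discriminants. -/
def regFundDiscSeries (m : ℕ) [NeZero m] (w : ℂ) : ℂ :=
  ((1 / 2 + (kroneckerSymbol 4 m : ℂ) * 4 ^ (-w) / 2 + (kroneckerSymbol 8 m : ℂ) * 8 ^ (-w)) *
      -- In the trivial case the entire function `LFunctionTrivChar₁` replaces `(w - 1) L(w, 1)`,
      -- which would have the wrong value at `w = 1`.
      (if kroneckerChar 0 m = 1 then DirichletCharacter.LFunctionTrivChar₁ (8 * m) w
        else (w - 1) * (kroneckerChar 0 m).LFunction w) +
    (1 / 2 - (kroneckerSymbol 4 m : ℂ) * 4 ^ (-w) / 2) *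
      ((w - 1) * (kroneckerChar 1 m).LFunction w)) *
    L (↗(1 : DirichletCharacter ℂ (8 * m)) * ↗μ) (2 * w)

theorem hasSum_regFundDiscSeries (m : ℕ) [NeZero m] {w : ℂ} (hw : 1 < w.re) :
    HasSum (fun d : posFundDisc =>
      (w - 1) * ((kroneckerSymbol (d : ℕ) m : ℂ) * ((d : ℕ) : ℂ) ^ (-w)))
      (regFundDiscSeries m w) := by
  have hw1 : w ≠ 1 := fun h => by simp [h] at hw
  have := (hasSum_kroneckerSymbol_posFundDisc m hw).mul_left (w - 1)
  refine (congrArg (HasSum _) ?_).mpr this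
  unfold regFundDiscSeries
  split_ifs with h
  · rw [DirichletCharacter.LFunctionTrivChar₁, Function.update_of_ne hw1, h]
    ring
  · ring

theorem differentiableAt_regFundDiscSeries (m : ℕ) [NeZero m] {w : ℂ} (hw : 1 / 2 < w.re) :
    DifferentiableAt ℂ (regFundDiscSeries m) w := by
  have h4 : DifferentiableAt ℂ (fun w : ℂ => (4 : ℂ) ^ (-w)) w :=
    differentiableAt_id.neg.const_cpow (.inl (by norm_num))
  have h8 : DifferentiableAt ℂ (fun w : ℂ => (8 : ℂ) ^ (-w)) w :=
    differentiableAt_id.neg.const_cpow (.inl (by norm_num))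
  have hR : DifferentiableAt ℂ
      (fun w => L (↗(1 : DirichletCharacter ℂ (8 * m)) * ↗μ) (2 * w)) w :=
    DifferentiableAt.comp w (differentiableAt_LSeries_one_mul_moebius (8 * m)
      (by simp; linarith)) (differentiableAt_id.const_mul 2)
  have h1 : DifferentiableAt ℂ (kroneckerChar 1 m).LFunction w :=
    DirichletCharacter.differentiable_LFunction (kroneckerChar_one_ne_one m) w
  have h0 : DifferentiableAt ℂ (fun w => if kroneckerChar 0 m = 1 then
      DirichletCharacter.LFunctionTrivChar₁ (8 * m) w
        else (w - 1) * (kroneckerChar 0 m).LFunction w) w := by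
    split_ifs with h
    · exact DirichletCharacter.differentiable_LFunctionTrivChar₁ (8 * m) w
    · exact (differentiableAt_id.sub_const 1).mul
        (DirichletCharacter.differentiable_LFunction h w)
  unfold regFundDiscSeries
  fun_prop

/-- Removing the Euler factors at primes dividing `q` reduces to level one, hence to the single
function `(w - 1) ζ(w)`, which is bounded on compact sets independently of `q`. -/
theorem norm_LFunctionTrivChar₁_le (q : ℕ) [NeZero q] {w : ℂ} (hw : 0 ≤ w.re) :
    ‖DirichletCharacter.LFunctionTrivChar₁ q w‖ ≤
      ‖DirichletCharacter.LFunctionTrivChar₁ 1 w‖ * 2 ^ q.primeFactors.card := by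
  have h : DirichletCharacter.LFunctionTrivChar₁ q w =
      DirichletCharacter.LFunctionTrivChar₁ 1 w *
        ∏ p ∈ q.primeFactors, (1 - (1 : DirichletCharacter ℂ 1) p * (p : ℂ) ^ (-w)) := by
    have h1 : ∀ p : ℕ, (1 : DirichletCharacter ℂ 1) (p : ZMod 1) = 1 := fun p =>
      MulChar.one_apply (isUnit_of_subsingleton _)
    simp only [h1, one_mul]
    rcases eq_or_ne w 1 with rfl | hw1
    · simp [DirichletCharacter.LFunctionTrivChar₁, Complex.cpow_neg_one]
    · rw [DirichletCharacter.LFunctionTrivChar₁, DirichletCharacter.LFunctionTrivChar₁,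
        Function.update_of_ne hw1, Function.update_of_ne hw1,
        DirichletCharacter.LFunctionTrivChar_eq_mul_riemannZeta hw1,
        DirichletCharacter.LFunctionTrivChar_eq_mul_riemannZeta hw1]
      simp
      ring
  rw [h, norm_mul]
  gcongr
  exact DirichletCharacter.norm_prod_one_sub_le _ hw

/-- Polynomial growth of `regFundDiscSeries m` in `m`, locally uniformly in `Re w > 1 / 2`. -/
theorem exists_norm_regFundDiscSeries_le {ε σ R : ℝ} (hε : 0 < ε) (hσ : 1 / 2 < σ) :
    ∃ C : ℝ, 0 < C ∧ ∀ (m : ℕ) [NeZero m] (w : ℂ), σ ≤ w.re → ‖w‖ ≤ R →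
      ‖regFundDiscSeries m w‖ ≤ C * (m : ℝ) ^ (1 / 4 + ε) := by
  obtain ⟨C₁, hC₁, h₁⟩ := Nat.exists_two_pow_card_primeFactors_le hε
  obtain ⟨C₂, hC₂, h₂⟩ := DirichletCharacter.exists_norm_LFunction_le (R := R) hε hσ
  obtain ⟨C₃, hC₃⟩ := (isCompact_closedBall (0 : ℂ) R).exists_bound_of_continuousOn
    (DirichletCharacter.differentiable_LFunctionTrivChar₁ 1).continuous.continuousOn
  set Z := ∑' n : ℕ, (n : ℝ) ^ (-(2 * σ)) with hZ
  have hZ0 : 0 ≤ Z := tsum_nonneg fun n => by positivity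
  set A := (|R| + 1) * C₂ + |C₃| * C₁ with hA
  refine ⟨3 * A * (Z + 1) * (8 : ℝ) ^ (1 / 4 + ε), by positivity, fun m _ w hw hwR => ?_⟩
  have hm : m ≠ 0 := NeZero.ne m
  have hA0 : 0 < A := by positivity
  have hw0 : 0 ≤ w.re := by linarith
  set X := ((8 * m : ℕ) : ℝ) ^ (1 / 4 + ε) with hX
  have hq1 : (1 : ℝ) ≤ ((8 * m : ℕ) : ℝ) := by
    exact_mod_cast Nat.pos_of_ne_zero (mul_ne_zero (by norm_num) hm)
  have hX0 : 0 < X := by positivity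
  have hsmall : ∀ c : ℕ, 0 < c → ‖(c : ℂ) ^ (-w)‖ ≤ 1 := fun c hc => by
    rw [Complex.norm_natCast_cpow_of_pos hc, Complex.neg_re]
    exact Real.rpow_le_one_of_one_le_of_nonpos (by exact_mod_cast hc) (by linarith)
  have hk4 : ‖(kroneckerSymbol 4 m : ℂ) * 4 ^ (-w)‖ ≤ 1 := by
    rw [norm_mul]
    exact mul_le_one₀ (norm_kroneckerSymbol_le_one _ hm) (norm_nonneg _)
      (by exact_mod_cast hsmall 4 (by norm_num))
  have hk8 : ‖(kroneckerSymbol 8 m : ℂ) * 8 ^ (-w)‖ ≤ 1 := by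
    rw [norm_mul]
    exact mul_le_one₀ (norm_kroneckerSymbol_le_one _ hm) (norm_nonneg _)
      (by exact_mod_cast hsmall 8 (by norm_num))
  have hL : ∀ χ : DirichletCharacter ℂ (8 * m), χ ≠ 1 → ‖(w - 1) * χ.LFunction w‖ ≤ A * X := by
    intro χ hχ
    rw [norm_mul]
    have hw1 : ‖w - 1‖ ≤ |R| + 1 := by
      refine (norm_sub_le _ _).trans ?_
      rw [norm_one]
      linarith [le_abs_self R]
    calc _ ≤ (|R| + 1) * (C₂ * X) := by
          gcongr
          exact h₂ _ χ hχ w hw hwR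
      _ = ((|R| + 1) * C₂) * X := by ring
      _ ≤ A * X := by
          gcongr
          rw [hA]
          exact le_add_of_nonneg_right (by positivity)
  have hT : ‖(if kroneckerChar 0 m = 1 then DirichletCharacter.LFunctionTrivChar₁ (8 * m) w
        else (w - 1) * (kroneckerChar 0 m).LFunction w)‖ ≤ A * X := by
    split_ifs with h
    · calc _ ≤ ‖DirichletCharacter.LFunctionTrivChar₁ 1 w‖ * 2 ^ (8 * m).primeFactors.card :=
            norm_LFunctionTrivChar₁_le _ hw0
        _ ≤ |C₃| * (C₁ * ((8 * m : ℕ) : ℝ) ^ ε) := by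
            gcongr
            · exact (hC₃ w (by simpa using hwR)).trans (le_abs_self _)
            · exact h₁ _ (Nat.pos_of_ne_zero (NeZero.ne _))
        _ ≤ |C₃| * (C₁ * X) := by
            gcongr
            exact Real.rpow_le_rpow_of_exponent_le hq1 (by linarith)
        _ = (|C₃| * C₁) * X := by ring
        _ ≤ A * X := by
            gcongr
            rw [hA]
            exact le_add_of_nonneg_left (by positivity)
    · exact hL _ h
  have hRn : ‖L (↗(1 : DirichletCharacter ℂ (8 * m)) * ↗μ) (2 * w)‖ ≤ Z + 1 :=
    (norm_LSeries_one_mul_moebius_le (8 * m) (σ := 2 * σ) (by linarith) (by simpa using hw)).trans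
      (by linarith)
  have hE : ‖1 / 2 + (kroneckerSymbol 4 m : ℂ) * 4 ^ (-w) / 2 +
      (kroneckerSymbol 8 m : ℂ) * 8 ^ (-w)‖ ≤ 2 := by
    refine (norm_add₃_le).trans ?_
    rw [norm_div _ (2 : ℂ)]
    norm_num
    norm_num at hk4 hk8
    linarith
  have hE' : ‖1 / 2 - (kroneckerSymbol 4 m : ℂ) * 4 ^ (-w) / 2‖ ≤ 1 := by
    refine (norm_sub_le _ _).trans ?_
    rw [norm_div _ (2 : ℂ)]
    norm_num
    norm_num at hk4
    linarith
  rw [regFundDiscSeries, norm_mul]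
  calc _ ≤ (2 * (A * X) + 1 * (A * X)) * (Z + 1) := by
        refine mul_le_mul ((norm_add_le _ _).trans (add_le_add ?_ ?_)) hRn (norm_nonneg _)
          (by positivity)
        · rw [norm_mul]
          exact mul_le_mul hE hT (norm_nonneg _) (by norm_num)
        · rw [norm_mul]
          exact mul_le_mul hE' (hL _ (kroneckerChar_one_ne_one m)) (norm_nonneg _) (by norm_num)
    _ = 3 * A * (Z + 1) * X := by ring
    _ = _ := by
        rw [hX, Nat.cast_mul, Real.mul_rpow (by positivity) (by positivity)]
        push_cast
        ring

theorem regFundDiscSeries_one_of_not_isSquare {m : ℕ} [NeZero m] (hm : ¬ IsSquare m) :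
    regFundDiscSeries m 1 = 0 := by
  simp [regFundDiscSeries, kroneckerChar_zero_ne_one hm]

theorem LSeries_one_mul_moebius_two (q : ℕ) [NeZero q] :
    L (↗(1 : DirichletCharacter ℂ q) * ↗μ) 2 =
      (riemannZeta 2 * ∏ p ∈ q.primeFactors, (1 - (p : ℂ)⁻¹ ^ 2))⁻¹ := by
  have h2 : 1 < (2 : ℂ).re := by norm_num
  have h := DirichletCharacter.LSeries.mul_mu_eq_one (1 : DirichletCharacter ℂ q) h2
  rw [← DirichletCharacter.LFunction_eq_LSeries _ h2] at h
  have h' := DirichletCharacter.LFunctionTrivChar_eq_mul_riemannZeta (N := q) (s := 2)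
    (by norm_num)
  rw [DirichletCharacter.LFunctionTrivChar] at h'
  rw [h'] at h
  rw [eq_inv_of_mul_eq_one_right h, mul_comm (riemannZeta 2)]
  congr 3
  funext p
  rw [Complex.cpow_neg, inv_pow]
  norm_num

/-- Only the trivial character survives at `w = 1`. Its residue divided by the value of the trivial
`L`-function at `2` is `1/ζ(2)` times `∏ (1 - p⁻¹) / (1 - p⁻²) = ∏ p / (p + 1)` over `p ∣ 8m`; it
remains to correct the prime `2`. -/
theorem regFundDiscSeries_one_of_isSquare {m : ℕ} [NeZero m] (hm : IsSquare m) :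
    regFundDiscSeries m 1 = 1 / (2 * riemannZeta 2) * arithA m := by
  have hm0 : m ≠ 0 := NeZero.ne m
  have hζ : riemannZeta 2 ≠ 0 := riemannZeta_ne_zero_of_one_lt_re (by norm_num)
  have hlocal : ∀ p : ℕ, p.Prime →
      (1 - (p : ℂ)⁻¹) * (1 - (p : ℂ)⁻¹ ^ 2)⁻¹ = (p : ℂ) / ((p : ℂ) + 1) := fun p hp => by
    have h0 : (p : ℂ) ≠ 0 := by exact_mod_cast hp.ne_zero
    have h1 : (p : ℂ) + 1 ≠ 0 := by exact_mod_cast (Nat.succ_ne_zero p)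
    have h2 : (p : ℂ) - 1 ≠ 0 := sub_ne_zero.mpr (by exact_mod_cast hp.ne_one)
    rw [show 1 - (p : ℂ)⁻¹ ^ 2 = ((p : ℂ) - 1) * ((p : ℂ) + 1) / (p : ℂ) ^ 2 by
      field_simp; ring]
    field_simp
  have hprod : (∏ p ∈ (8 * m).primeFactors, (1 - (p : ℂ)⁻¹)) *
      (riemannZeta 2 * ∏ p ∈ (8 * m).primeFactors, (1 - (p : ℂ)⁻¹ ^ 2))⁻¹ =
      1 / riemannZeta 2 * arithA (8 * m) := by
    rw [arithA, mul_inv, mul_left_comm, one_div, ← Finset.prod_inv_distrib,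
      ← Finset.prod_mul_distrib]
    congr 1
    exact Finset.prod_congr rfl fun p hp => hlocal p (Nat.prime_of_mem_primeFactors hp)
  have hpf : (8 * m).primeFactors = insert 2 m.primeFactors := by
    rw [Nat.primeFactors_mul (by norm_num) hm0, show (8 : ℕ) = 2 ^ 3 by norm_num,
      Nat.primeFactors_prime_pow (by norm_num) Nat.prime_two]
    rfl
  have hval : regFundDiscSeries m 1 = (1 / 2 + (kroneckerSymbol 4 m : ℂ) / 8 +
      (kroneckerSymbol 8 m : ℂ) / 8) * (1 / riemannZeta 2 * arithA (8 * m)) := by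
    rw [← hprod, regFundDiscSeries, if_pos (kroneckerChar_zero_eq_one hm), mul_one (2 : ℂ),
      LSeries_one_mul_moebius_two, DirichletCharacter.LFunctionTrivChar₁, Function.update_self,
      sub_self, zero_mul, mul_zero, add_zero, Complex.cpow_neg_one, Complex.cpow_neg_one]
    ring
  rw [hval]
  obtain ⟨r, rfl⟩ := hm
  have hr : r ≠ 0 := fun h => hm0 (by simp [h])
  -- For odd `m` the prefactor is `1/2 + 1/8 + 1/8 = 3/4`, and the extra factor `2/3` at `p = 2`
  -- brings it to `1/2`. For even `m` the symbols `(4/m)` and `(8/m)` vanish, the prefactor is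
  -- `1/2`, and `2` already divides `m`.
  by_cases hodd : Odd (r * r)
  · have hrodd : Odd r := (Nat.odd_mul.mp hodd).1
    have hf : r.factorization 2 = 0 := Nat.factorization_eq_zero_of_not_dvd fun h => by
      exact Nat.not_even_iff_odd.mpr hrodd (even_iff_two_dvd.mpr h)
    have hk : ∀ k : ℕ, kroneckerSymbol ((2 ^ k : ℕ) : ℤ) (r * r) = 1 := fun k => by
      rw [kroneckerSymbol_mul_right _ hr hr, kroneckerSymbol_of_ne_zero _ hr, hf, pow_zero,
        pow_zero, one_mul, Nat.div_one, ← sq]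
      refine jacobiSym.sq_one ?_
      rw [Int.gcd_natCast_natCast]
      exact (Nat.coprime_two_left.mpr hrodd).pow_left k
    have hk4 : kroneckerSymbol 4 (r * r) = 1 := hk 2
    have hk8 : kroneckerSymbol 8 (r * r) = 1 := hk 3
    have h2 : 2 ∉ (r * r).primeFactors := fun h =>
      Nat.not_even_iff_odd.mpr hodd (even_iff_two_dvd.mpr (Nat.dvd_of_mem_primeFactors h))
    rw [hk4, hk8, arithA, arithA, hpf, Finset.prod_insert h2]
    push_cast
    field_simp
    norm_num
  · have hrev : ¬ Odd r := fun h => hodd (h.mul h)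
    have h2r : 2 ∣ r := even_iff_two_dvd.mp (Nat.not_odd_iff_even.mp hrev)
    have hf : r.factorization 2 ≠ 0 := (Nat.prime_two.factorization_pos_of_dvd hr h2r).ne'
    have hk : ∀ c : ℕ, ¬ Odd c → kroneckerSymbol (c : ℤ) (r * r) = 0 := fun c hc => by
      rw [kroneckerSymbol_mul_right _ hr hr, kroneckerSymbol_of_ne_zero _ hr, Int.cast_natCast,
        ZMod.χ₈_natCast_eq_zero hc, zero_pow hf]
      simp
    have hk4 : kroneckerSymbol 4 (r * r) = 0 := hk 4 (by decide)
    have hk8 : kroneckerSymbol 8 (r * r) = 0 := hk 8 (by decide)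
    have h2 : 2 ∈ (r * r).primeFactors :=
      Nat.mem_primeFactors.mpr ⟨Nat.prime_two, h2r.mul_right r, hm0⟩
    rw [hk4, hk8, arithA, arithA, hpf, Finset.insert_eq_of_mem h2]
    push_cast
    field_simp
    norm_num

end FundamentalDiscriminants

/-! ### Normally convergent series of holomorphic functions on normed spaces -/

section HolomorphicSeries

/-- Cauchy's estimate in one variable, on the disc of radius `r / ‖v‖` in the complex line through
`x` in direction `v`. -/
theorem norm_fderiv_le_of_norm_le {E : Type*} [NormedAddCommGroup E] [NormedSpace ℂ E]
    {g : E → ℂ} {x : E} {r C : ℝ} (hr : 0 < r) (hC : 0 ≤ C)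
    (hg : ∀ y ∈ Metric.closedBall x r, DifferentiableAt ℂ g y)
    (hb : ∀ y ∈ Metric.closedBall x r, ‖g y‖ ≤ C) : ‖fderiv ℂ g x‖ ≤ C / r := by
  refine ContinuousLinearMap.opNorm_le_bound _ (by positivity) fun v => ?_
  rcases eq_or_ne v 0 with rfl | hv
  · simp
  have hv0 : 0 < ‖v‖ := norm_pos_iff.mpr hv
  have hmem : ∀ t ∈ Metric.closedBall (0 : ℂ) (r / ‖v‖), x + t • v ∈ Metric.closedBall x r := by
    intro t ht
    rw [mem_closedBall_zero_iff, le_div_iff₀ hv0] at ht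
    simpa [norm_smul] using ht
  have hl : ∀ t : ℂ, HasDerivAt (fun t : ℂ => x + t • v) v t := fun t => by
    simpa using ((hasDerivAt_id t).smul_const v).const_add x
  have hd : deriv (fun t : ℂ => g (x + t • v)) 0 = fderiv ℂ g x v := by
    have h0 : HasFDerivAt g (fderiv ℂ g x) (x + (0 : ℂ) • v) := by
      simpa using (hg x (Metric.mem_closedBall_self hr.le)).hasFDerivAt
    exact (h0.comp_hasDerivAt 0 (hl 0)).deriv
  have hdiff : DifferentiableOn ℂ (fun t : ℂ => g (x + t • v))
      (Metric.closedBall 0 (r / ‖v‖)) := fun t ht =>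
    (DifferentiableAt.comp t (hg _ (hmem t ht)) (hl t).differentiableAt).differentiableWithinAt
  have := Complex.norm_deriv_le_of_forall_mem_sphere_norm_le (c := 0) (div_pos hr hv0)
    (hdiff.diffContOnCl_ball subset_rfl)
    fun t ht => hb _ (hmem t (Metric.sphere_subset_closedBall ht))
  rw [hd] at this
  refine this.trans_eq ?_
  field_simp

/-- **Weierstrass' theorem** on locally normally convergent series of holomorphic functions on
an open subset of a complex normed space. -/
theorem differentiableOn_tsum_of_locally_summable_norm {E ι : Type*} [NormedAddCommGroup E]
    [NormedSpace ℂ E] {U : Set E} (hU : IsOpen U) {g : ι → E → ℂ}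
    (hg : ∀ i, DifferentiableOn ℂ (g i) U)
    (hb : ∀ p ∈ U, ∃ u : ι → ℝ, Summable u ∧ ∀ᶠ x in 𝓝 p, ∀ i, ‖g i x‖ ≤ u i) :
    DifferentiableOn ℂ (fun x => ∑' i, g i x) U := by
  intro p hp
  obtain ⟨u, hu, hev⟩ := hb p hp
  obtain ⟨r, hr, hball⟩ := Metric.eventually_nhds_iff_ball.mp (hev.and (hU.mem_nhds hp))
  -- Halving the radius leaves room for a Cauchy estimate around each point of the smaller ball, so
  -- the derivatives are summably bounded there.
  have hr2 : 0 < r / 2 := by positivity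
  have hu0 : ∀ i, 0 ≤ u i := fun i =>
    (norm_nonneg _).trans ((hball p (Metric.mem_ball_self hr)).1 i)
  have hsub : ∀ x ∈ Metric.ball p (r / 2), ∀ y ∈ Metric.closedBall x (r / 2),
      y ∈ Metric.ball p r := by
    intro x hx y hy
    rw [Metric.mem_ball] at hx ⊢
    rw [Metric.mem_closedBall] at hy
    linarith [dist_triangle y x p]
  have hda : ∀ i, ∀ y ∈ Metric.ball p r, DifferentiableAt ℂ (g i) y := fun i y hy =>
    (hg i).differentiableAt (hU.mem_nhds (hball y hy).2)
  refine (hasFDerivAt_tsum_of_isPreconnected (hu.mul_right (1 / (r / 2))) Metric.isOpen_ball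
    (convex_ball p (r / 2)).isPreconnected (f' := fun i x => fderiv ℂ (g i) x) ?_ ?_
    (Metric.mem_ball_self hr2) ?_
    (Metric.mem_ball_self hr2)).differentiableAt.differentiableWithinAt
  · intro i x hx
    exact (hda i x (Metric.ball_subset_ball (by linarith) hx)).hasFDerivAt
  · intro i x hx
    rw [mul_one_div]
    exact norm_fderiv_le_of_norm_le hr2 (hu0 i) (fun y hy => hda i y (hsub x hx y hy))
      fun y hy => (hball y (hsub x hx y hy)).1 i
  · exact Summable.of_norm_bounded hu (hball p (Metric.mem_ball_self hr)).1

theorem summable_norm_prod_and_hasSum_prod {𝕜 α : Type*} [NormedField 𝕜] [CompleteSpace 𝕜] :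
    ∀ {k : ℕ} (g : Fin k → α → 𝕜), (∀ j, Summable fun a => ‖g j a‖) →
      (Summable fun n : Fin k → α => ‖∏ j, g j (n j)‖) ∧
        HasSum (fun n : Fin k → α => ∏ j, g j (n j)) (∏ j, ∑' a, g j a) := by
  intro k
  induction k with
  | zero =>
    intro g _
    refine ⟨(hasSum_unique _).summable, ?_⟩
    simp
  | succ k ih =>
    intro g hg
    obtain ⟨h1, h2⟩ := ih (fun j => g j.succ) fun j => hg _
    have hs := (hg 0).mul_norm h1
    have hcomp : ∀ x : α × (Fin k → α),
        (∏ j, g j ((Fin.consEquiv fun _ => α) x j)) = g 0 x.1 * ∏ j, g (Fin.succ j) (x.2 j) :=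
      fun x => by simp [Fin.prod_univ_succ, Fin.consEquiv]
    constructor
    · rw [← (Fin.consEquiv fun _ => α).summable_iff]
      refine hs.congr fun x => ?_
      simp only [Function.comp, hcomp]
    · rw [← (Fin.consEquiv fun _ => α).hasSum_iff, Fin.prod_univ_succ, ← h2.tsum_eq,
        tsum_mul_tsum_of_summable_norm (hg 0) h1]
      rw [show ((fun n : Fin (k + 1) → α => ∏ j, g j (n j)) ∘ (Fin.consEquiv fun _ => α)) =
        fun x => g 0 x.1 * ∏ j, g (Fin.succ j) (x.2 j) from funext hcomp]
      exact hs.of_norm.hasSum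

end HolomorphicSeries

/-! ### Interchange of summations and the continued multiple Dirichlet series -/

section Continuation

/-- The integer `M n_1 ⋯ n_k`. -/
def mulProd (M : ℕ+) {k : ℕ} (n : Fin k → ℕ+) : ℕ+ := M * ∏ j, n j

theorem coe_mulProd (M : ℕ+) {k : ℕ} (n : Fin k → ℕ+) :
    (mulProd M n : ℕ) = M * ∏ j, (n j : ℕ) := by
  rw [mulProd, PNat.mul_coe]
  congr 1
  exact map_prod PNat.coeMonoidHom n Finset.univ

/-- The coefficient `a_f(n_1) ⋯ a_f(n_k) n_1 ^ (-s_1) ⋯ n_k ^ (-s_k)`. -/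
def coeffProd {κ : ℤ} (f : CuspForm 𝒮ℒ κ) {k : ℕ} (s : Fin k → ℂ) (n : Fin k → ℕ+) : ℂ :=
  ∏ j, (normCoeff f (n j) * ((n j : ℕ) : ℂ) ^ (-(s j)))

/-- The continuation of `(w - 1) A_{f,M}(s_1, …, s_k; w)`. -/
def regMds {κ : ℤ} (f : CuspForm 𝒮ℒ κ) (M : ℕ+) {k : ℕ} (p : (Fin k → ℂ) × ℂ) : ℂ :=
  ∑' n : Fin k → ℕ+, coeffProd f p.1 n * regFundDiscSeries (mulProd M n) p.2

theorem PNat.norm_cpow_neg (n : ℕ+) (s : ℂ) :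
    ‖((n : ℕ) : ℂ) ^ (-s)‖ = ((n : ℕ) : ℝ) ^ (-s.re) := by
  rw [Complex.norm_natCast_cpow_of_pos n.pos, Complex.neg_re]

theorem CuspForm.summable_norm_normCoeff_mul_cpow {κ : ℤ} (f : CuspForm 𝒮ℒ κ) {s : ℂ}
    (hs : 1 < s.re) : Summable fun n : ℕ+ => ‖normCoeff f n * ((n : ℕ) : ℂ) ^ (-s)‖ := by
  simp_rw [norm_mul, PNat.norm_cpow_neg]
  exact f.summable_norm_normCoeff_mul_rpow hs

theorem summable_norm_coeffProd {κ : ℤ} (f : CuspForm 𝒮ℒ κ) {k : ℕ} {s : Fin k → ℂ}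
    (hs : ∀ j, 1 < (s j).re) : Summable fun n : Fin k → ℕ+ => ‖coeffProd f s n‖ :=
  (summable_norm_prod_and_hasSum_prod
    (fun j (n : ℕ+) => normCoeff f n * ((n : ℕ) : ℂ) ^ (-(s j)))
    fun j => f.summable_norm_normCoeff_mul_cpow (hs j)).1

theorem isOpen_contRegion (k : ℕ) : IsOpen (contRegion k) := by
  have : contRegion k = (⋂ j, {p : (Fin k → ℂ) × ℂ | 5 / 4 < (p.1 j).re}) ∩
      {p | 1 / 2 < p.2.re} := by
    ext p
    simp [contRegion]
  rw [this]
  refine (isOpen_iInter_of_finite fun j => ?_).inter ?_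
  · exact isOpen_lt continuous_const (by fun_prop)
  · exact isOpen_lt continuous_const (by fun_prop)

/-- The growth `(M n_1 ⋯ n_k)^{1/4+δ}` is split among the variables. Each exponent `5/4 + 2δ` pays
`1/4 + δ` for it and keeps `1 + δ`, enough for the coefficient series to converge absolutely. -/
theorem exists_summable_bound_regMds {κ : ℤ} (f : CuspForm 𝒮ℒ κ) (M : ℕ+) {k : ℕ}
    {p : (Fin k → ℂ) × ℂ} (hp : p ∈ contRegion k) :
    ∃ u : (Fin k → ℕ+) → ℝ, Summable u ∧ ∀ᶠ x : (Fin k → ℂ) × ℂ in 𝓝 p, ∀ n,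
      ‖coeffProd f x.1 n * regFundDiscSeries (mulProd M n) x.2‖ ≤ u n := by
  obtain ⟨δ, hδ0, hδ⟩ : ∃ δ : ℝ, 0 < δ ∧
      (∀ j, 5 / 4 + 2 * δ < (p.1 j).re) ∧ 1 / 2 + δ < p.2.re := by
    have h1 : ∀ᶠ δ : ℝ in 𝓝[>] 0, ∀ j, 5 / 4 + 2 * δ < (p.1 j).re := by
      refine eventually_all.mpr fun j => mem_nhdsWithin_of_mem_nhds ?_
      refine (isOpen_lt (by fun_prop) continuous_const).mem_nhds ?_
      simpa using hp.1 j
    have h2 : ∀ᶠ δ : ℝ in 𝓝[>] 0, 1 / 2 + δ < p.2.re := by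
      refine mem_nhdsWithin_of_mem_nhds ?_
      refine (isOpen_lt (by fun_prop) continuous_const).mem_nhds ?_
      simpa using hp.2
    obtain ⟨δ, h⟩ := (h1.and (h2.and self_mem_nhdsWithin)).exists
    exact ⟨δ, h.2.2, h.1, h.2.1⟩
  obtain ⟨C, hC0, hC⟩ := exists_norm_regFundDiscSeries_le (ε := δ) (σ := 1 / 2 + δ)
    (R := ‖p.2‖ + 1) hδ0 (by linarith)
  refine ⟨fun n => (C * ((M : ℕ) : ℝ) ^ (1 / 4 + δ)) *
    ‖∏ j, (‖normCoeff f (n j)‖ * ((n j : ℕ) : ℝ) ^ (-(1 + δ)))‖, ?_, ?_⟩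
  · refine Summable.mul_left _ (summable_norm_prod_and_hasSum_prod
      (fun (_ : Fin k) (n : ℕ+) => ‖normCoeff f n‖ * ((n : ℕ) : ℝ) ^ (-(1 + δ))) fun j => ?_).1
    refine (f.summable_norm_normCoeff_mul_rpow (σ := 1 + δ) (by linarith)).congr fun n => ?_
    rw [Real.norm_of_nonneg (by positivity)]
  · have e1 : ∀ᶠ x : (Fin k → ℂ) × ℂ in 𝓝 p, ∀ j, 5 / 4 + 2 * δ < (x.1 j).re :=
      eventually_all.mpr fun j =>
        (isOpen_lt continuous_const (by fun_prop)).mem_nhds (hδ.1 j)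
    have e2 : ∀ᶠ x : (Fin k → ℂ) × ℂ in 𝓝 p, 1 / 2 + δ < x.2.re :=
      (isOpen_lt continuous_const (by fun_prop)).mem_nhds hδ.2
    have e3 : ∀ᶠ x : (Fin k → ℂ) × ℂ in 𝓝 p, ‖x.2‖ < ‖p.2‖ + 1 :=
      (isOpen_lt (by fun_prop) continuous_const).mem_nhds (by simp)
    filter_upwards [e1, e2, e3] with x h1 h2 h3 n
    rw [norm_mul]
    have hG := hC (mulProd M n) x.2 h2.le h3.le
    rw [Real.norm_of_nonneg (Finset.prod_nonneg fun j _ => by positivity)]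
    calc _ ≤ (∏ j, (‖normCoeff f (n j)‖ * ((n j : ℕ) : ℝ) ^ (-(5 / 4 + 2 * δ)))) *
          (C * ((mulProd M n : ℕ) : ℝ) ^ (1 / 4 + δ)) := by
          refine mul_le_mul ?_ hG (norm_nonneg _) (Finset.prod_nonneg fun j _ => by positivity)
          rw [coeffProd, norm_prod]
          refine Finset.prod_le_prod (fun j _ => norm_nonneg _) fun j _ => ?_
          rw [norm_mul, PNat.norm_cpow_neg]
          gcongr
          · exact_mod_cast (n j).pos
          · exact (h1 j).le
      _ = C * ((M : ℕ) : ℝ) ^ (1 / 4 + δ) * ∏ j, ((‖normCoeff f (n j)‖ *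
          ((n j : ℕ) : ℝ) ^ (-(5 / 4 + 2 * δ))) * ((n j : ℕ) : ℝ) ^ (1 / 4 + δ)) := by
          rw [coe_mulProd, Nat.cast_mul, Nat.cast_prod,
            Real.mul_rpow (by positivity) (by positivity),
            ← Real.finsetProd_rpow _ _ (fun _ _ => by positivity)]
          simp only [Finset.prod_mul_distrib]
          ring
      _ = _ := by
          congr 1
          refine Finset.prod_congr rfl fun j _ => ?_
          have hn : (0 : ℝ) < ((n j : ℕ) : ℝ) := by exact_mod_cast (n j).pos
          rw [mul_assoc, ← Real.rpow_add hn]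
          congr 2
          ring

theorem differentiableOn_regMds {κ : ℤ} (f : CuspForm 𝒮ℒ κ) (M : ℕ+) (k : ℕ) :
    DifferentiableOn ℂ (regMds f M (k := k)) (contRegion k) := by
  refine differentiableOn_tsum_of_locally_summable_norm (isOpen_contRegion k) (fun n p hp => ?_)
    fun p hp => exists_summable_bound_regMds f M hp
  refine DifferentiableAt.differentiableWithinAt (DifferentiableAt.mul ?_ ?_)
  · unfold coeffProd
    have h : ∀ j ∈ Finset.univ, DifferentiableAt ℂ (fun p : (Fin k → ℂ) × ℂ =>
        normCoeff f (n j) * ((n j : ℕ) : ℂ) ^ (-(p.1 j))) p := fun j _ =>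
      (DifferentiableAt.const_cpow (by fun_prop)
        (.inl (by exact_mod_cast (n j).ne_zero))).const_mul _
    exact (HasFDerivAt.finsetProd fun j hj => (h j hj).hasFDerivAt).differentiableAt
  · exact DifferentiableAt.comp p (differentiableAt_regFundDiscSeries _ hp.2)
      differentiableAt_snd

theorem twistL_term_eq {κ : ℤ} (f : CuspForm 𝒮ℒ κ) (d : ℕ) (s : ℂ) (n : ℕ+) :
    LSeries.term (twistCoeff f d) s n =
      normCoeff f n * ((n : ℕ) : ℂ) ^ (-s) * (kroneckerSymbol (d : ℤ) n : ℂ) := by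
  rw [LSeries.term_of_ne_zero n.ne_zero, twistCoeff, Complex.cpow_neg, div_eq_mul_inv]
  ring

theorem summable_norm_twistL_term {κ : ℤ} (f : CuspForm 𝒮ℒ κ) (d : ℕ) {s : ℂ} (hs : 1 < s.re) :
    Summable fun n : ℕ+ => ‖LSeries.term (twistCoeff f d) s n‖ := by
  refine Summable.of_nonneg_of_le (fun _ => norm_nonneg _) (fun n => ?_)
    (f.summable_norm_normCoeff_mul_cpow hs)
  rw [twistL_term_eq, norm_mul]
  exact mul_le_of_le_one_right (norm_nonneg _) (norm_kroneckerSymbol_le_one _ n.ne_zero)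

theorem LSeries_term_eq_zero_of_notMem_range (a : ℕ → ℂ) (s : ℂ) (n : ℕ)
    (hn : n ∉ Set.range ((↑) : ℕ+ → ℕ)) : LSeries.term a s n = 0 := by
  have : n = 0 := by
    by_contra h
    exact hn ⟨⟨n, Nat.pos_of_ne_zero h⟩, rfl⟩
  rw [this, LSeries.term_zero]

theorem lseriesSummable_twistCoeff {κ : ℤ} (f : CuspForm 𝒮ℒ κ) (d : ℕ) {s : ℂ} (hs : 1 < s.re) :
    LSeriesSummable (twistCoeff f d) s :=
  (PNat.coe_injective.summable_iff fun n hn =>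
    LSeries_term_eq_zero_of_notMem_range _ s n hn).mp (summable_norm_twistL_term f d hs).of_norm

theorem twistL_eq_tsum {κ : ℤ} (f : CuspForm 𝒮ℒ κ) (d : ℕ) (s : ℂ) :
    twistL f d s = ∑' n : ℕ+, normCoeff f n * ((n : ℕ) : ℂ) ^ (-s) *
      (kroneckerSymbol (d : ℤ) n : ℂ) := by
  simp_rw [← twistL_term_eq]
  rw [twistL, LSeries]
  refine (PNat.coe_injective.tsum_eq fun n hn => ?_).symm
  by_contra h
  exact hn (LSeries_term_eq_zero_of_notMem_range _ s n h)

theorem hasSum_prod_twistL {κ : ℤ} (f : CuspForm 𝒮ℒ κ) (d : ℕ) {k : ℕ} {s : Fin k → ℂ}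
    (hs : ∀ j, 1 < (s j).re) :
    HasSum (fun n : Fin k → ℕ+ => coeffProd f s n * ∏ j, (kroneckerSymbol (d : ℤ) (n j) : ℂ))
      (∏ j, twistL f d (s j)) := by
  have h := (summable_norm_prod_and_hasSum_prod (fun j (n : ℕ+) =>
    normCoeff f n * ((n : ℕ) : ℂ) ^ (-(s j)) * (kroneckerSymbol (d : ℤ) n : ℂ)) fun j => by
      simpa only [twistL_term_eq] using summable_norm_twistL_term f d (hs j)).2
  simp_rw [twistL_eq_tsum]
  simpa only [coeffProd, Finset.prod_mul_distrib] using h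

theorem summable_posFundDisc_rpow {σ : ℝ} (hσ : 1 < σ) :
    Summable fun d : posFundDisc => ((d : ℕ) : ℝ) ^ (-σ) :=
  (Real.summable_nat_rpow.mpr (by linarith)).comp_injective Subtype.val_injective

theorem norm_cpow_posFundDisc (d : posFundDisc) (w : ℂ) :
    ‖((d : ℕ) : ℂ) ^ (-w)‖ = ((d : ℕ) : ℝ) ^ (-w.re) := by
  rw [Complex.norm_natCast_cpow_of_pos d.2.1, Complex.neg_re]

/-- The double series obtained by expanding all the `L`-functions converges absolutely. -/
theorem summable_double_series {κ : ℤ} (f : CuspForm 𝒮ℒ κ) (M : ℕ+) {k : ℕ} {s : Fin k → ℂ}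
    {w : ℂ} (hs : ∀ j, 1 < (s j).re) (hw : 1 < w.re) :
    Summable fun x : (Fin k → ℕ+) × posFundDisc => ‖coeffProd f s x.1 *
      ((kroneckerSymbol ((x.2 : ℕ) : ℤ) (mulProd M x.1) : ℂ) * ((x.2 : ℕ) : ℂ) ^ (-w))‖ := by
  have h := (summable_norm_coeffProd f hs).mul_norm (g := fun d : posFundDisc =>
    ((d : ℕ) : ℂ) ^ (-w)) (by
      simp_rw [norm_cpow_posFundDisc]
      exact summable_posFundDisc_rpow hw)
  refine Summable.of_nonneg_of_le (fun _ => norm_nonneg _) (fun x => ?_) h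
  rw [norm_mul, norm_mul, norm_mul]
  gcongr
  exact mul_le_of_le_one_left (norm_nonneg _)
    (norm_kroneckerSymbol_le_one _ (mulProd M x.1).ne_zero)

theorem hasSum_mdsTerm {κ : ℤ} (f : CuspForm 𝒮ℒ κ) (M : ℕ+) {k : ℕ} {s : Fin k → ℂ}
    (w : ℂ) (hs : ∀ j, 1 < (s j).re) (d : ℕ) :
    HasSum (fun n : Fin k → ℕ+ => coeffProd f s n *
      ((kroneckerSymbol (d : ℤ) (mulProd M n) : ℂ) * (d : ℂ) ^ (-w))) (mdsTerm f M s w d) := by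
  have h := ((hasSum_prod_twistL f d hs).mul_left (kroneckerSymbol (d : ℤ) M : ℂ)).mul_right
    ((d : ℂ) ^ (-w))
  rw [mdsTerm, div_eq_mul_inv, ← Complex.cpow_neg]
  refine (congrArg (fun g => HasSum g _) (funext fun n => ?_)).mpr h
  rw [coe_mulProd, kroneckerSymbol_mul_right _ M.ne_zero
    (Finset.prod_ne_zero_iff.mpr fun j _ => (n j).ne_zero),
    kroneckerSymbol_prod_right _ _ _ fun j _ => (n j).ne_zero]
  push_cast
  ring

theorem summable_norm_mdsTerm {κ : ℤ} (f : CuspForm 𝒮ℒ κ) (M : ℕ+) {k : ℕ} {s : Fin k → ℂ}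
    {w : ℂ} (hs : ∀ j, 1 < (s j).re) (hw : 1 < w.re) :
    Summable fun d : posFundDisc => ‖mdsTerm f M s w (d : ℕ)‖ := by
  have h := (summable_double_series f M hs hw).prod_symm
  refine Summable.of_nonneg_of_le (fun _ => norm_nonneg _) (fun d => ?_) h.prod
  rw [← (hasSum_mdsTerm f M w hs d).tsum_eq]
  exact norm_tsum_le_tsum_norm (h.prod_factor d)

/-- Absolute convergence of the double series permits summing over `d` first, which produces
`regFundDiscSeries` for each tuple. -/
theorem regMds_eq {κ : ℤ} (f : CuspForm 𝒮ℒ κ) (M : ℕ+) {k : ℕ} {s : Fin k → ℂ} {w : ℂ}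
    (hs : ∀ j, 1 < (s j).re) (hw : 1 < w.re) :
    regMds f M (s, w) = (w - 1) * mdsA f M s w := by
  have h := (summable_double_series f M hs hw).of_norm
  rw [mdsA, regMds]
  simp_rw [← (hasSum_mdsTerm f M w hs _).tsum_eq]
  rw [h.tsum_comm (f := fun (n : Fin k → ℕ+) (d : posFundDisc) => coeffProd f s n *
    ((kroneckerSymbol ((d : ℕ) : ℤ) (mulProd M n) : ℂ) * ((d : ℕ) : ℂ) ^ (-w))), ← tsum_mul_left]
  refine tsum_congr fun n => ?_
  rw [← (hasSum_regFundDiscSeries (mulProd M n) hw).tsum_eq, tsum_mul_left, tsum_mul_left]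
  ring

theorem norm_arithA_le_one (n : ℕ) : ‖arithA n‖ ≤ 1 := by
  rw [arithA, norm_prod]
  refine Finset.prod_le_one (fun _ _ => norm_nonneg _) fun p _ => ?_
  have h : ((p : ℂ) + 1) = ((p + 1 : ℕ) : ℂ) := by push_cast; ring
  rw [h, norm_div, Complex.norm_natCast, Complex.norm_natCast]
  exact div_le_one_of_le₀ (by push_cast; linarith) (by positivity)

theorem hTerm_eq {κ : ℤ} (f : CuspForm 𝒮ℒ κ) (M : ℕ+) {k : ℕ} (s : Fin k → ℂ)
    (n : Fin k → ℕ+) : hTerm f M s n =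
      coeffProd f s n * if IsSquare (mulProd M n : ℕ) then arithA (mulProd M n) else 0 := by
  rw [hTerm, ← coe_mulProd]
  split_ifs
  · rw [coeffProd, Finset.prod_mul_distrib]
    simp_rw [Complex.cpow_neg]
    rw [Finset.prod_inv_distrib]
    ring
  · simp

theorem summable_norm_hTerm {κ : ℤ} (f : CuspForm 𝒮ℒ κ) (M : ℕ+) {k : ℕ} {s : Fin k → ℂ}
    (hs : ∀ j, 1 < (s j).re) : Summable fun n : Fin k → ℕ+ => ‖hTerm f M s n‖ := by
  refine Summable.of_nonneg_of_le (fun _ => norm_nonneg _) (fun n => ?_)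
    (summable_norm_coeffProd f hs)
  rw [hTerm_eq, norm_mul]
  refine mul_le_of_le_one_right (norm_nonneg _) ?_
  split_ifs
  · exact norm_arithA_le_one _
  · simp

/-- The two series agree term by term. No limit is exchanged here: the passage `w → 1` is supplied
by the continuity of `regMds`. -/
theorem regMds_one {κ : ℤ} (f : CuspForm 𝒮ℒ κ) (M : ℕ+) {k : ℕ} (s : Fin k → ℂ) :
    regMds f M (s, 1) = hSum f M s := by
  rw [regMds, hSum, ← tsum_mul_left]
  refine tsum_congr fun n => ?_
  rw [hTerm_eq]
  split_ifs with h
  · rw [regFundDiscSeries_one_of_isSquare h]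
    ring
  · rw [regFundDiscSeries_one_of_not_isSquare h]
    ring

/-- Any analytic factor witnessing order `-1` agrees with `g` on a punctured neighbourhood, hence
also at `c` by continuity; conversely `g` itself is a witness. -/
theorem meromorphicOrderAt_div_sub_eq_neg_one_iff {g F : ℂ → ℂ} {c : ℂ} (hg : AnalyticAt ℂ g c)
    (hF : ∀ w, F w = g w / (w - c)) :
    meromorphicOrderAt F c = ((-1 : ℤ) : WithTop ℤ) ↔ g c ≠ 0 := by
  have hmer : MeromorphicAt F c := by
    rw [funext hF]
    exact hg.meromorphicAt.div (by fun_prop)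
  rw [meromorphicOrderAt_eq_int_iff hmer]
  constructor
  · rintro ⟨g', hg', hne, hev⟩
    have h : g' =ᶠ[𝓝[≠] c] g := by
      filter_upwards [hev, self_mem_nhdsWithin] with w hw hwc
      have hwc : w - c ≠ 0 := sub_ne_zero.mpr hwc
      rw [hF w, zpow_neg_one, smul_eq_mul] at hw
      field_simp at hw
      exact hw.symm
    have h1 := hg'.continuousAt.tendsto.mono_left (nhdsWithin_le_nhds (s := {c}ᶜ))
    have h2 := hg.continuousAt.tendsto.mono_left (nhdsWithin_le_nhds (s := {c}ᶜ))
    rwa [← tendsto_nhds_unique h1 (h2.congr' h.symm)]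
  · intro hne
    refine ⟨g, hg, hne, Eventually.of_forall fun w => ?_⟩
    rw [hF w, zpow_neg_one, smul_eq_mul, div_eq_mul_inv, mul_comm]

end Continuation

end

theorem mainTheorem7 {κ : ℤ} (f : CuspForm 𝒮ℒ κ) (hf : IsHeckeEigencuspform f)
    (k M : ℕ) (hk : 0 < k) (hM : 0 < M) :
    -- absolute convergence for `Re s_j > 1`, `Re w > 1`
    (∀ (s : Fin k → ℂ) (w : ℂ), (∀ j, 1 < (s j).re) → 1 < w.re →
      (∀ d ∈ posFundDisc, ∀ j, LSeriesSummable (twistCoeff f d) (s j)) ∧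
      Summable (fun d : posFundDisc => ‖mdsTerm f M s w (d : ℕ)‖)) ∧
    -- meromorphic continuation `F` to `contRegion k`
    ∃ F : (Fin k → ℂ) × ℂ → ℂ,
      (∀ p ∈ contRegion k, 1 < p.2.re → F p = mdsA f M p.1 p.2) ∧
      -- `F` is holomorphic off `w = 1`, and `(w - 1) F` extends holomorphically across `w = 1`
      DifferentiableOn ℂ F (contRegion k ∩ {p | p.2 ≠ 1}) ∧
      (∃ G : (Fin k → ℂ) × ℂ → ℂ, DifferentiableOn ℂ G (contRegion k) ∧
        ∀ p ∈ contRegion k, p.2 ≠ 1 → G p = (p.2 - 1) * F p) ∧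
      -- the residue at `w = 1` is `H_{f,M}(S)`, and the pole is simple where the residue is nonzero
      ∀ s : Fin k → ℂ, (∀ j, 5 / 4 < (s j).re) →
        Summable (fun n : Fin k → ℕ+ => ‖hTerm f M s n‖) ∧
        Tendsto (fun w : ℂ => (w - 1) * F (s, w)) (𝓝[≠] 1) (𝓝 (hSum f M s)) ∧
        (meromorphicOrderAt (fun w : ℂ => F (s, w)) 1 = ((-1 : ℤ) : WithTop ℤ) ↔
          hSum f M s ≠ 0) := by
  lift M to ℕ+ using hM
  have hG := differentiableOn_regMds f M k
  refine ⟨fun s w hs hw => ⟨fun d _ j => lseriesSummable_twistCoeff f d (hs j),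
    -- At `w = 1` this quotient has the default value `0`, which is harmless: holomorphy, limit and
    -- order only see `w ≠ 1`.
    summable_norm_mdsTerm f M hs hw⟩, fun p => regMds f M p / (p.2 - 1), ?_, ?_,
    ⟨regMds f M, hG, ?_⟩, ?_⟩
  · intro p hp hw
    have hne : p.2 - 1 ≠ 0 := fun h => by
      rw [sub_eq_zero.mp h] at hw
      simp at hw
    rw [div_eq_iff hne, mul_comm]
    exact regMds_eq f M (fun j => lt_trans (by norm_num) (hp.1 j)) hw
  · simp_rw [div_eq_mul_inv]
    exact (hG.mono Set.inter_subset_left).mul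
      (DifferentiableOn.inv (by fun_prop) fun p hp => sub_ne_zero.mpr hp.2)
  · intro p _ hp
    rw [mul_div_cancel₀ _ (sub_ne_zero.mpr hp)]
  · intro s hs
    have hs1 : ∀ j, 1 < (s j).re := fun j => lt_trans (by norm_num) (hs j)
    have hopen : IsOpen {w : ℂ | 1 / 2 < w.re} := isOpen_lt continuous_const Complex.continuous_re
    have hg : DifferentiableOn ℂ (fun w => regMds f M (s, w)) {w : ℂ | 1 / 2 < w.re} :=
      hG.comp (by fun_prop) fun w hw => ⟨hs, hw⟩
    have han : AnalyticAt ℂ (fun w => regMds f M (s, w)) 1 :=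
      hg.analyticAt (hopen.mem_nhds (by norm_num))
    refine ⟨summable_norm_hTerm f M hs1, ?_, ?_⟩
    · rw [← regMds_one]
      refine (han.continuousAt.tendsto.mono_left nhdsWithin_le_nhds).congr' ?_
      filter_upwards [self_mem_nhdsWithin] with w hw
      rw [mul_div_cancel₀ _ (sub_ne_zero.mpr hw)]
    · rw [← regMds_one]
      exact meromorphicOrderAt_div_sub_eq_neg_one_iff han fun w => rfl
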